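/- Setting. Let $\mathcal H=\bigotimes_{i=1}^m\mathcal H_i$ with $\mathcal H_i=\mathbb C^{d_i}$ finite-dimensional and $D=\prod_i d_i$. A pure product state is a vector $\bigotimes_i\varphi_i$ with all $\varphi_i$ unit vectors. An orthogonal product basis (PB) is a set $S$ of mutually orthogonal pure product states in $\mathcal H$ (not necessarily spanning $\mathcal H$); write $\mathcal H_S=\operatorname{span}S$. A PB $S$ is *uncompletable* (UCPB) if every set of mutually orthogonal product states in $\mathcal H_S^\perp$ has fewer than $\dim\mathcal H_S^\perp$ elements; *unextendible* (UPB) if it is a UCPB and $\mathcal H_S^\perp$ contains no product state; *strongly uncompletable* (SUCPB) if it is uncompletable when viewed in every locally extended space $\bigotimes_i(\mathcal H_i\oplus\mathcal H_i')$ with finite-dimensional $\mathcal H_i'$ (possibly zero). Put $\bar\rho_S=\frac1{D-|S|}\bigl(\mathbf 1-\sum_{\psi\in S}|\psi\rangle\langle\psi|\bigr)$, the normalized projector onto $\mathcal H_S^\perp$. A density matrix is separable if it is a finite nonnegative combination of projectors onto pure product states, and entangled otherwise. It is distillable if there is a fixed pure entangled (non-product) state $\phi$ of the $m$ parties such that for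 every $\varepsilon>0$ there are an integer $n$ and a finite-round procedure $\mathcal S$ of local quantum operations and classical communication among the $m$ parties with $\langle\phi|\mathcal S(\rho^{\otimes n})|\phi\rangle\ge1-\varepsilon$ (for two parties one may take $\phi$ to be the two-qubit singlet). A density matrix that is entangled but not distillable is bound entangled. (a) For every UCPB $S$ on $\mathcal H=\bigotimes_{i=1}^m\mathcal H_i$ there is a (possibly empty) set $T$ of mutually orthogonal product states, all orthogonal to $S$, such that for $S^+=S\cup T$ the matrix $\bar\rho_{S^+}$ is a bound entangled density matrix. (b) In $\mathbb C^3\otimes\mathbb C^4$ let, for $j=0,\dots,4$, $$v_j=\tfrac{2}{\sqrt{5+\sqrt5}}\bigl(\cos\tfrac{2\pi j}5,\ \sin\tfrac{2\pi j}5,\ \tfrac12\sqrt{1+\sqrt5}\bigr),$$ $$w_j=\sqrt{\tfrac2{\sqrt5}}\Bigl(\sqrt{\cos\tfrac\pi5}\cos\tfrac{2\pi j}5,\ \sqrt{\cos\tfrac\pi5}\sin\tfrac{2\pi j}5,\ \sqrt{\cos\tfrac{2\pi}5}\cos\tfrac{4\pi j}5,\ \sqrt{\cos\tfrac{2\pi}5}\sin\tfrac{4\pi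 j}5\Bigr),$$ let $\mathrm{Pyr34}=\{v_j\otimes w_j: j=0,\dots,4\}$, let $u$ be a unit vector orthogonal to $w_0,w_1,w_4$ (such a vector exists; it is unique up to a phase) and let $\mathrm{Pyr34}^+=\mathrm{Pyr34}\cup\{v_0\otimes u\}$. Then $\mathrm{Pyr34}$ is a UCPB, and $\mathrm{Pyr34}^+$ has six elements, is an SUCPB and is not a UPB; the state $\bar\rho_{\mathrm{Pyr34}^+}$ has rank $6$ and is bound entangled, and its range contains, up to scalar factors, exactly four product states. -/

import Mathlib

noncomputable section

namespace ProductBasis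

/-- The state space `ℂ^{d 0} ⊗ ⋯ ⊗ ℂ^{d (m-1)}` of `m` parties with local dimensions `d i`,
in the product coordinates. -/
abbrev Space {m : ℕ} (d : Fin m → ℕ) : Type := EuclideanSpace ℂ (∀ i, Fin (d i))

/-- Operators on `Space d`, as matrices in the product coordinates. -/
abbrev Op {m : ℕ} (d : Fin m → ℕ) : Type := Matrix (∀ i, Fin (d i)) (∀ i, Fin (d i)) ℂ

/-- The product vector `φ 0 ⊗ ⋯ ⊗ φ (m-1)`. -/
def tensor {m : ℕ} {d : Fin m → ℕ} (φ : ∀ i, EuclideanSpace ℂ (Fin (d i))) : Space d :=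
  WithLp.toLp 2 fun x => ∏ i, φ i (x i)

/-- Pure product states: tensor products of unit vectors. -/
def IsProductState {m : ℕ} {d : Fin m → ℕ} (ψ : Space d) : Prop :=
  ∃ φ : ∀ i, EuclideanSpace ℂ (Fin (d i)), (∀ i, ‖φ i‖ = 1) ∧ ψ = tensor φ

/-- The rank-one operator `|ψ⟩⟨ψ|`. -/
def proj {m : ℕ} {d : Fin m → ℕ} (ψ : Space d) : Op d :=
  Matrix.vecMulVec ψ.ofLp (star ψ.ofLp)

/-! ### Product bases -/

/-- Orthogonal product basis (PB): a set of mutually orthogonal pure product states. -/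
def IsPB {m : ℕ} {d : Fin m → ℕ} (S : Finset (Space d)) : Prop :=
  (∀ ψ ∈ S, IsProductState ψ) ∧ ∀ ψ ∈ S, ∀ χ ∈ S, ψ ≠ χ → inner ℂ ψ χ = 0

/-- The complementary subspace of `S`. -/
def compl {m : ℕ} {d : Fin m → ℕ} (S : Finset (Space d)) : Submodule ℂ (Space d) :=
  (Submodule.span ℂ (S : Set (Space d)))ᗮ

/-- Uncompletable product basis: a PB whose complementary subspace contains fewer mutually
orthogonal product states than its dimension. -/
def IsUCPB {m : ℕ} {d : Fin m → ℕ} (S : Finset (Space d)) : Prop :=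
  IsPB S ∧ ∀ T : Finset (Space d), IsPB T → (∀ ψ ∈ T, ψ ∈ compl S) →
    T.card < Module.finrank ℂ (compl S)

/-- Unextendible product basis: a UCPB whose complementary subspace contains no product state. -/
def IsUPB {m : ℕ} {d : Fin m → ℕ} (S : Finset (Space d)) : Prop :=
  IsUCPB S ∧ ∀ ψ ∈ compl S, ¬ IsProductState ψ

/-- The embedding of `⨂ ℂ^{d i}` in the locally extended space `⨂ ℂ^{e i}`, `d i ≤ e i`,
where `ℂ^{e i} = ℂ^{d i} ⊕ ℂ^{e i - d i}`: extension of coordinates by zero. -/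
def embed {m : ℕ} {d : Fin m → ℕ} (e : Fin m → ℕ) (ψ : Space d) : Space e :=
  WithLp.toLp 2 fun x =>
    if hx : ∀ i, (x i : ℕ) < d i then ψ (fun i => ⟨x i, hx i⟩) else 0

open Classical in
/-- Strongly uncompletable product basis: uncompletable in every locally extended space. -/
def IsSUCPB {m : ℕ} {d : Fin m → ℕ} (S : Finset (Space d)) : Prop :=
  IsPB S ∧ ∀ e : Fin m → ℕ, (∀ i, d i ≤ e i) → IsUCPB (S.image (embed e))

/-- The complementary state `(D - n)⁻¹ (1 - ∑ |ψ_j⟩⟨ψ_j|)` of a PB with `n` members in total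
dimension `D`. -/
def complState {m : ℕ} {d : Fin m → ℕ} (S : Finset (Space d)) : Op d :=
  ((∏ i, (d i : ℂ)) - (S.card : ℂ))⁻¹ • (1 - ∑ ψ ∈ S, proj ψ)

/-! ### Entanglement -/

open scoped ComplexOrder in
/-- Density matrices. -/
def IsDensity {m : ℕ} {d : Fin m → ℕ} (ρ : Op d) : Prop :=
  ρ.PosSemidef ∧ ρ.trace = 1

/-- Separable: a finite nonnegative combination of projectors on pure product states. -/
def IsSeparable {m : ℕ} {d : Fin m → ℕ} (ρ : Op d) : Prop :=
  ∃ (N : ℕ) (p : Fin N → ℝ) (ψ : Fin N → Space d),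
    (∀ k, 0 ≤ p k) ∧ (∀ k, IsProductState (ψ k)) ∧ ρ = ∑ k, (p k : ℂ) • proj (ψ k)

/-- The tensor product `A 0 ⊗ ⋯ ⊗ A (m-1)` of local operators. -/
def tensorOp {m : ℕ} {d e : Fin m → ℕ} (A : ∀ i, Matrix (Fin (e i)) (Fin (d i)) ℂ) :
    Matrix (∀ i, Fin (e i)) (∀ i, Fin (d i)) ℂ :=
  Matrix.of fun x y => ∏ i, A i (x i) (y i)

/-- Maps of operators implemented by local quantum operations and classical communication in
finitely many rounds. In a round, party `j` performs a measurement with Kraus operators `A a j`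
and broadcasts the outcome `a`; the other parties then apply local isometries `A a i`, and the
protocol goes on with a procedure `T a` that may depend on the outcome. (The outcome may be
ignored, so local channels, partial traces, ancillas and shared randomness are included; the
local dimensions may change.) -/
inductive IsLOCC {m : ℕ} : (d e : Fin m → ℕ) → (Op d → Op e) → Prop
  | done (d : Fin m → ℕ) : IsLOCC d d id
  | round {d e : Fin m → ℕ} (j : Fin m) (r : ℕ) (c : Fin r → Fin m → ℕ)
      (A : ∀ (a : Fin r) (i : Fin m), Matrix (Fin (c a i)) (Fin (d i)) ℂ)
      (hj : ∑ a, (A a j).conjTranspose * A a j = 1)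
      (hi : ∀ a i, i ≠ j → (A a i).conjTranspose * A a i = 1)
      (T : ∀ a : Fin r, Op (c a) → Op e)
      (hT : ∀ a, IsLOCC (c a) e (T a)) :
      IsLOCC d e fun ρ => ∑ a, T a (tensorOp (A a) * ρ * (tensorOp (A a)).conjTranspose)

/-- `ρ^{⊗n}` as an operator of the same `m` parties, party `i` holding its `n` subsystems
`(ℂ^{d i})^{⊗n} = ℂ^{(d i)^n}`. -/
def tensorPow {m : ℕ} {d : Fin m → ℕ} (ρ : Op d) (n : ℕ) : Op (fun i => d i ^ n) :=
  Matrix.of fun x y => ∏ k : Fin n,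
    ρ (fun i => finFunctionFinEquiv.symm (x i) k) (fun i => finFunctionFinEquiv.symm (y i) k)

/-- The fidelity `⟨φ|σ|φ⟩`. -/
def fidelity {m : ℕ} {d : Fin m → ℕ} (φ : Space d) (σ : Op d) : ℝ :=
  (star φ.ofLp ⬝ᵥ σ.mulVec φ.ofLp).re

/-- Distillable: some pure entangled state `φ` of the `m` parties (for instance a two-qubit
singlet held by two of them) can be obtained with arbitrarily high fidelity by LQ+CC from
sufficiently many copies of `ρ`. -/
def IsDistillable {m : ℕ} {d : Fin m → ℕ} (ρ : Op d) : Prop :=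
  ∃ (e : Fin m → ℕ) (φ : Space e), ‖φ‖ = 1 ∧ ¬ IsProductState φ ∧
    ∀ ε : ℝ, 0 < ε → ∃ (n : ℕ) (T : Op (fun i => d i ^ n) → Op e),
      IsLOCC (fun i => d i ^ n) e T ∧ 1 - ε ≤ fidelity φ (T (tensorPow ρ n))

/-- Bound entangled: a density matrix that is entangled but not distillable. -/
def IsBoundEntangled {m : ℕ} {d : Fin m → ℕ} (ρ : Op d) : Prop :=
  IsDensity ρ ∧ ¬ IsSeparable ρ ∧ ¬ IsDistillable ρ

/-! ### The example in `3 ⊗ 4` -/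

/-- `v ⊗ w` for two parties. -/
def tmul {a b : ℕ} (v : EuclideanSpace ℂ (Fin a)) (w : EuclideanSpace ℂ (Fin b)) :
    Space ![a, b] :=
  WithLp.toLp 2 fun x => v (x 0) * w (x 1)

/-- The vectors `v_j` of the regular pentagonal pyramid. -/
def pyrV (j : Fin 5) : EuclideanSpace ℂ (Fin 3) :=
  (2 / Real.sqrt (5 + Real.sqrt 5)) •
    !₂[(Real.cos (2 * Real.pi * (j : ℕ) / 5) : ℂ), (Real.sin (2 * Real.pi * (j : ℕ) / 5) : ℂ),
      ((1 / 2 * Real.sqrt (1 + Real.sqrt 5) : ℝ) : ℂ)]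

/-- The vectors `w_j` in dimension four. -/
def pyrW (j : Fin 5) : EuclideanSpace ℂ (Fin 4) :=
  Real.sqrt (2 / Real.sqrt 5) •
    !₂[((Real.sqrt (Real.cos (Real.pi / 5)) * Real.cos (2 * (j : ℕ) * Real.pi / 5) : ℝ) : ℂ),
      ((Real.sqrt (Real.cos (Real.pi / 5)) * Real.sin (2 * (j : ℕ) * Real.pi / 5) : ℝ) : ℂ),
      ((Real.sqrt (Real.cos (2 * Real.pi / 5)) * Real.cos (4 * (j : ℕ) * Real.pi / 5) : ℝ) : ℂ),
      ((Real.sqrt (Real.cos (2 * Real.pi / 5)) * Real.sin (4 * (j : ℕ) * Real.pi / 5) : ℝ) : ℂ)]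

open Classical in
/-- The five states `v_j ⊗ w_j` of **Pyr34**. -/
def pyr34 : Finset (Space ![3, 4]) :=
  Finset.univ.image fun j : Fin 5 => tmul (pyrV j) (pyrW j)

/-- `u` is the unit vector `(w_0, w_1, w_4)^⊥` (unique up to a phase). -/
def IsPyrU (u : EuclideanSpace ℂ (Fin 4)) : Prop :=
  ‖u‖ = 1 ∧ inner ℂ (pyrW 0) u = 0 ∧ inner ℂ (pyrW 1) u = 0 ∧ inner ℂ (pyrW 4) u = 0

open Classical in
/-- **Pyr34**⁺: **Pyr34** together with `v_0 ⊗ u`. -/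
def pyr34Plus (u : EuclideanSpace ℂ (Fin 4)) : Finset (Space ![3, 4]) :=
  insert (tmul (pyrV 0) u) pyr34

/-- The lines spanned by the product states in the range of `ρ`, i.e. these product states
up to a scalar factor. -/
def productLines {m : ℕ} {d : Fin m → ℕ} (ρ : Op d) : Set (Submodule ℂ (Space d)) :=
  {L | ∃ ψ : Space d, IsProductState ψ ∧ ψ ∈ LinearMap.range (Matrix.toEuclideanLin ρ) ∧
    L = Submodule.span ℂ {ψ}}

end ProductBasis

end

open ProductBasis

/-! Bound entanglement of a complementary state splits into two independent facts.

Not distillable: partial transposition conjugates one tensor factor of every member of a product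
basis, which leaves the members orthonormal. The partial transpose of the complementary state is
therefore again a scaled projector, so it is positive (`IsPB.posSemidef_ptr_complState`). This
positivity survives tensor powers and LOCC. An entangled `φ` fails to be a product across some cut
`{i} | rest`, where its largest squared Schmidt coefficient `c` is below one. A trace-one operator
with positive partial transpose at `i` has fidelity at most `c` with `φ`
(`fidelity_le_of_posSemidef_ptr`).

Entangled: the range of a separable state is spanned by product states lying in it, so it suffices
that the product states of the complement span too little (`IsPB.not_isSeparable_complState`). For
(a), a largest orthogonal extension `T` leaves no product state in the complement, which is nonzero
by uncompletability.

For (b), if `x ⊗ y` is orthogonal to every `v j ⊗ w j`, then for each `j` either `x ⟂ v j` or `y ⟂ w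
j`. Any three `v j` span dimension three and any four `w j` span dimension four, so `x` is
orthogonal to exactly two of the `v j` and `y` to the other three `w j`. The ten pairs, sides and
diagonals of the pentagon, give ten lines. A side line is orthogonal to exactly four others, so
mutually orthogonal product states in the seven-dimensional complement number at most five. The
vector `v 0 ⊗ u` spans a side line. After adding it, only its four neighbours remain in a complement
of dimension six, so the state is entangled. Strong uncompletability follows: a completion in a
larger space, compressed to the original one, would write the complementary state as a separable
state. -/

noncomputable section

namespace ProductBasis

open Matrix

open scoped ComplexOrder

/-! ### Partial transposition -/

section PartialTranspose

variable {m : ℕ} {d e : Fin m → ℕ}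

/-- Exchange of the `i`-th components of two tuples. -/
def swapAt (d : Fin m → ℕ) (i : Fin m) :
    Equiv.Perm ((∀ k, Fin (d k)) × (∀ k, Fin (d k))) :=
  Function.Involutive.toPerm
    (fun p => (Function.update p.1 i (p.2 i), Function.update p.2 i (p.1 i)))
    (fun p => by simp)

theorem swapAt_apply (i : Fin m) (p : (∀ k, Fin (d k)) × (∀ k, Fin (d k))) :
    swapAt d i p = (Function.update p.1 i (p.2 i), Function.update p.2 i (p.1 i)) := rfl

/-- Partial transposition with respect to party `i`. -/
def ptr (i : Fin m) (ρ : Op d) : Op d :=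
  Matrix.of fun x y => ρ (Function.update x i (y i)) (Function.update y i (x i))

theorem ptr_apply (i : Fin m) (ρ : Op d) (x y : ∀ k, Fin (d k)) :
    ptr i ρ x y = ρ (Function.update x i (y i)) (Function.update y i (x i)) := rfl

theorem ptr_add (i : Fin m) (ρ σ : Op d) : ptr i (ρ + σ) = ptr i ρ + ptr i σ := rfl

theorem ptr_sub (i : Fin m) (ρ σ : Op d) : ptr i (ρ - σ) = ptr i ρ - ptr i σ := rfl

theorem ptr_smul (i : Fin m) (c : ℂ) (ρ : Op d) : ptr i (c • ρ) = c • ptr i ρ := rfl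

theorem ptr_zero (i : Fin m) : ptr i (0 : Op d) = 0 := rfl

theorem ptr_sum (i : Fin m) {ι : Type*} (s : Finset ι) (ρ : ι → Op d) :
    ptr i (∑ a ∈ s, ρ a) = ∑ a ∈ s, ptr i (ρ a) := by
  classical
  induction s using Finset.induction_on with
  | empty => simp [ptr_zero]
  | insert a s ha ih => rw [Finset.sum_insert ha, Finset.sum_insert ha, ptr_add, ih]

theorem ptr_one (i : Fin m) : ptr i (1 : Op d) = 1 := by
  ext x y
  rw [ptr_apply, Matrix.one_apply, Matrix.one_apply]
  congr 1
  apply propext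
  constructor
  · intro h
    funext k
    have hk := congrFun h k
    by_cases hki : k = i
    · subst hki; simpa using hk.symm
    · simpa [hki] using hk
  · rintro rfl; rfl

/-- Complex conjugation of the coordinates. -/
def conjVec {n : ℕ} (v : EuclideanSpace ℂ (Fin n)) : EuclideanSpace ℂ (Fin n) :=
  WithLp.toLp 2 (star v.ofLp)

theorem proj_apply (ψ : Space d) (x y : ∀ k, Fin (d k)) : proj ψ x y = ψ x * star (ψ y) := rfl

theorem tensor_apply (φ : ∀ i, EuclideanSpace ℂ (Fin (d i))) (x : ∀ k, Fin (d k)) :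
    tensor φ x = ∏ i, φ i (x i) := rfl

/-- The factor of party `i` is Hermitian, so transposing it is the same as conjugating it entrywise.
-/
theorem ptr_proj_tensor (i : Fin m) (φ : ∀ i, EuclideanSpace ℂ (Fin (d i))) :
    ptr i (proj (tensor φ)) = proj (tensor (Function.update φ i (conjVec (φ i)))) := by
  ext x y
  simp only [ptr_apply, proj_apply, tensor_apply, star_prod, ← Finset.prod_mul_distrib]
  refine Finset.prod_congr rfl fun k _ => ?_
  by_cases hki : k = i
  · subst hki; simp [conjVec, mul_comm]
  · simp [hki]

/-- Partial transposition passes through a product Kraus operator at the cost of conjugating its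
factor at `i`. This is why LOCC preserves positivity of the partial transpose. -/
theorem ptr_tensorOp_conj (i : Fin m) (A : ∀ i, Matrix (Fin (e i)) (Fin (d i)) ℂ) (ρ : Op d) :
    ptr i (tensorOp A * ρ * (tensorOp A)ᴴ) =
      tensorOp (Function.update A i ((A i).map star)) * ptr i ρ *
        (tensorOp (Function.update A i ((A i).map star)))ᴴ := by
  have key : ∀ (B : ∀ i, Matrix (Fin (e i)) (Fin (d i)) ℂ) (σ : Op d) (x y : ∀ k, Fin (e k)),
      (tensorOp B * σ * (tensorOp B)ᴴ) x y =
        ∑ p : (∀ k, Fin (d k)) × (∀ k, Fin (d k)),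
          (∏ k, B k (x k) (p.1 k) * star (B k (y k) (p.2 k))) * σ p.1 p.2 := by
    intro B σ x y
    rw [Fintype.sum_prod_type_right]
    simp only [Matrix.mul_apply, conjTranspose_apply, tensorOp, Matrix.of_apply, Finset.sum_mul,
      star_prod, Finset.prod_mul_distrib]
    refine Finset.sum_congr rfl fun q _ => Finset.sum_congr rfl fun p _ => ?_
    ring
  ext x y
  rw [ptr_apply, key, key]
  -- Exchanging the `i`-th components of the two summation indices undoes the transposition of `ρ`
  -- and moves it onto the Kraus factors.
  refine (Equiv.sum_comp (swapAt d i) _).symm.trans (Finset.sum_congr rfl fun p _ => ?_)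
  rw [swapAt_apply, ptr_apply]
  congr 1
  refine Finset.prod_congr rfl fun k _ => ?_
  by_cases hki : k = i
  · subst hki; simp [mul_comm]
  · simp [hki]

end PartialTranspose

/-! ### Operations -/

section LOCC

variable {m : ℕ} {d e : Fin m → ℕ}

theorem tensorOp_conjTranspose_mul_self (A : ∀ i, Matrix (Fin (e i)) (Fin (d i)) ℂ) :
    (tensorOp A)ᴴ * tensorOp A = tensorOp fun i => (A i)ᴴ * A i := by
  ext x y
  simp only [Matrix.mul_apply, conjTranspose_apply, tensorOp, Matrix.of_apply, star_prod,
    ← Finset.prod_mul_distrib]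
  exact (Fintype.prod_sum fun i j => star (A i j (x i)) * A i j (y i)).symm

theorem tensorOp_one : tensorOp (fun i => (1 : Matrix (Fin (d i)) (Fin (d i)) ℂ)) = 1 := by
  ext x y
  simp only [tensorOp, Matrix.of_apply, Matrix.one_apply]
  by_cases h : x = y
  · subst h; simp
  · obtain ⟨k, hk⟩ := Function.ne_iff.mp h
    rw [if_neg h]
    exact Finset.prod_eq_zero (Finset.mem_univ k) (if_neg hk)

theorem sum_tensorOp_update {ι : Type*} (s : Finset ι) (j : Fin m)
    (B : ∀ i, Matrix (Fin (e i)) (Fin (d i)) ℂ) (C : ι → Matrix (Fin (e j)) (Fin (d j)) ℂ) :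
    ∑ a ∈ s, tensorOp (Function.update B j (C a)) =
      tensorOp (Function.update B j (∑ a ∈ s, C a)) := by
  ext x y
  have h : ∀ M : Matrix (Fin (e j)) (Fin (d j)) ℂ, tensorOp (Function.update B j M) x y =
      M (x j) (y j) * ∏ i ∈ Finset.univ.erase j, B i (x i) (y i) := by
    intro M
    simp only [tensorOp, Matrix.of_apply]
    rw [← Finset.mul_prod_erase _ _ (Finset.mem_univ j)]
    congr 1
    · simp
    · exact Finset.prod_congr rfl fun i hi => by simp [Finset.ne_of_mem_erase hi]
  rw [Matrix.sum_apply, h, Finset.sum_congr rfl fun a _ => h (C a), ← Finset.sum_mul,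
    Matrix.sum_apply]

theorem IsLOCC.posSemidef_ptr {T : Op d → Op e} (hT : IsLOCC d e T) (i : Fin m) :
    ∀ ρ : Op d, (ptr i ρ).PosSemidef → (ptr i (T ρ)).PosSemidef := by
  induction hT with
  | done d => exact fun ρ h => h
  | round j r c A hj hi T hT ih =>
    intro ρ h
    rw [ptr_sum]
    refine Matrix.posSemidef_sum _ fun a _ => ih a _ ?_
    rw [ptr_tensorOp_conj]
    exact h.mul_mul_conjTranspose_same _

theorem IsLOCC.trace_eq {T : Op d → Op e} (hT : IsLOCC d e T) :
    ∀ ρ : Op d, (T ρ).trace = ρ.trace := by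
  induction hT with
  | done d => exact fun ρ => rfl
  | @round d e j r c A hj hi T hT ih =>
    intro ρ
    rw [Matrix.trace_sum, Finset.sum_congr rfl fun a _ => ih a _]
    -- The isometries of the other parties cancel, leaving an operator of party `j` alone. The
    -- completeness relation then sums these to the identity.
    have hA : ∀ a, (tensorOp (A a))ᴴ * tensorOp (A a) =
        tensorOp (Function.update (fun i => (1 : Matrix (Fin (d i)) (Fin (d i)) ℂ)) j
          ((A a j)ᴴ * A a j)) := by
      intro a
      rw [tensorOp_conjTranspose_mul_self]
      congr 1
      funext i
      by_cases hij : i = j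
      · subst hij; simp
      · simp [hij, hi a i hij]
    have h1 : ∀ a, (tensorOp (A a) * ρ * (tensorOp (A a))ᴴ).trace =
        ((tensorOp (A a))ᴴ * tensorOp (A a) * ρ).trace := by
      intro a
      rw [Matrix.trace_mul_comm, ← Matrix.mul_assoc]
    rw [Finset.sum_congr rfl fun a _ => h1 a, ← Matrix.trace_sum, ← Finset.sum_mul,
      Finset.sum_congr rfl fun a _ => hA a, sum_tensorOp_update, hj, Function.update_eq_self,
      tensorOp_one, Matrix.one_mul]

end LOCC

/-! ### Tensor powers -/

section TensorPower

variable {m : ℕ} {d : Fin m → ℕ}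

/-- The `k`-th copy of a joint index of `n` copies. -/
def copyIndex {n : ℕ} (x : ∀ i : Fin m, Fin (d i ^ n)) (k : Fin n) : ∀ i, Fin (d i) :=
  fun i => finFunctionFinEquiv.symm (x i) k

theorem tensorPow_apply (ρ : Op d) (n : ℕ) (x y : ∀ i : Fin m, Fin (d i ^ n)) :
    tensorPow ρ n x y = ∏ k, ρ (copyIndex x k) (copyIndex y k) := rfl

/-- A joint index of `n` copies is a family of `n` indices. -/
def copyEquiv (d : Fin m → ℕ) (n : ℕ) :
    (∀ i : Fin m, Fin (d i ^ n)) ≃ (Fin n → ∀ i, Fin (d i)) :=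
  (Equiv.piCongrRight fun i => (finFunctionFinEquiv (m := d i) (n := n)).symm).trans
    (Equiv.piComm fun i _ => Fin (d i))

theorem sum_prod_copyIndex (n : ℕ) (f : Fin n → (∀ i, Fin (d i)) → ℂ) :
    ∑ x : ∀ i : Fin m, Fin (d i ^ n), ∏ k, f k (copyIndex x k) = ∏ k, ∑ x, f k x := by
  rw [Fintype.prod_sum]
  exact Equiv.sum_comp (copyEquiv d n) fun x => ∏ k, f k (x k)

theorem trace_tensorPow (ρ : Op d) (n : ℕ) : (tensorPow ρ n).trace = ρ.trace ^ n := by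
  simp only [Matrix.trace, Matrix.diag_apply, tensorPow_apply]
  rw [sum_prod_copyIndex n fun _ x => ρ x x]
  simp

theorem ptr_tensorPow (i : Fin m) (ρ : Op d) (n : ℕ) :
    ptr i (tensorPow ρ n) = tensorPow (ptr i ρ) n := by
  have h : ∀ (x y : ∀ i : Fin m, Fin (d i ^ n)) (k : Fin n),
      copyIndex (Function.update x i (y i)) k =
        Function.update (copyIndex x k) i (copyIndex y k i) := by
    intro x y k
    funext l
    by_cases hl : l = i
    · subst hl; simp [copyIndex]
    · simp [copyIndex, hl]
  ext x y
  simp only [ptr_apply, tensorPow_apply, h]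

theorem exists_eq_conjTranspose_mul_self {n : Type*} [Fintype n] [DecidableEq n]
    {A : Matrix n n ℂ} (hA : A.PosSemidef) : ∃ B : Matrix n n ℂ, A = Bᴴ * B := by
  open scoped MatrixOrder Matrix.Norms.L2Operator in
  exact CStarAlgebra.nonneg_iff_eq_star_mul_self.mp hA.nonneg

/-- Tensor powers are multiplicative, so a factorization `Bᴴ * B` passes to the power. -/
theorem posSemidef_tensorPow {ρ : Op d} (hρ : ρ.PosSemidef) (n : ℕ) :
    (tensorPow ρ n).PosSemidef := by
  obtain ⟨B, rfl⟩ := exists_eq_conjTranspose_mul_self hρ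
  have : tensorPow (Bᴴ * B) n = (tensorPow B n)ᴴ * tensorPow B n := by
    ext x y
    simp only [Matrix.mul_apply, conjTranspose_apply, tensorPow_apply, star_prod,
      ← Finset.prod_mul_distrib]
    exact (sum_prod_copyIndex n
      fun k z => star (B z (copyIndex x k)) * B z (copyIndex y k)).symm
  rw [this]
  exact Matrix.posSemidef_conjTranspose_mul_self _

end TensorPower

/-! ### Product vectors -/

section ProductVectors

variable {m : ℕ} {d : Fin m → ℕ}

theorem inner_tensor (φ χ : ∀ i, EuclideanSpace ℂ (Fin (d i))) :
    inner ℂ (tensor φ) (tensor χ) = ∏ i, inner ℂ (φ i) (χ i) := by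
  simp only [PiLp.inner_apply, tensor_apply, RCLike.inner_apply, map_prod,
    ← Finset.prod_mul_distrib]
  exact (Fintype.prod_sum fun i j => χ i j * (starRingEnd ℂ) (φ i j)).symm

theorem norm_tensor (φ : ∀ i, EuclideanSpace ℂ (Fin (d i))) :
    ‖tensor φ‖ = ∏ i, ‖φ i‖ := by
  have h : ((‖tensor φ‖ ^ 2 : ℝ) : ℂ) = ((∏ i, ‖φ i‖) ^ 2 : ℝ) := by
    have := inner_tensor φ φ
    simp only [inner_self_eq_norm_sq_to_K] at this
    push_cast
    rw [← Finset.prod_pow]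
    exact this
  have h2 : ‖tensor φ‖ ^ 2 = (∏ i, ‖φ i‖) ^ 2 := by exact_mod_cast h
  exact (pow_left_inj₀ (norm_nonneg _) (Finset.prod_nonneg fun i _ => norm_nonneg _)
    two_ne_zero).mp h2

theorem tensor_smul (c : Fin m → ℂ) (φ : ∀ i, EuclideanSpace ℂ (Fin (d i))) :
    tensor (fun i => c i • φ i) = (∏ i, c i) • tensor φ := by
  ext x
  simp [tensor_apply, Finset.prod_mul_distrib]

theorem IsProductState.norm_eq_one {ψ : Space d} (h : IsProductState ψ) : ‖ψ‖ = 1 := by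
  obtain ⟨φ, hφ, rfl⟩ := h
  simp [norm_tensor, hφ]

theorem IsProductState.ne_zero {ψ : Space d} (h : IsProductState ψ) : ψ ≠ 0 := by
  rw [← norm_ne_zero_iff, h.norm_eq_one]
  exact one_ne_zero

theorem isProductState_tensor (φ : ∀ i, EuclideanSpace ℂ (Fin (d i))) (h : ‖tensor φ‖ = 1) :
    IsProductState (tensor φ) := by
  have hn : ∏ i, ‖φ i‖ = 1 := by rw [← norm_tensor, h]
  have hne : ∀ i, ‖φ i‖ ≠ 0 := fun i hi =>
    one_ne_zero (hn.symm.trans (Finset.prod_eq_zero (Finset.mem_univ i) hi))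
  refine ⟨fun i => ((‖φ i‖⁻¹ : ℝ) : ℂ) • φ i, fun i => ?_, ?_⟩
  · rw [norm_smul, Complex.norm_real, norm_inv, norm_norm, inv_mul_cancel₀ (hne i)]
  · rw [tensor_smul, ← Complex.ofReal_prod, Finset.prod_inv_distrib, hn]
    simp

/-- The scalar is absorbed by the factor of party `i₀`. Some party is required: with none, the only
product state is the vector `1`, and a phase times it is not one. -/
theorem isProductState_smul_tensor (i₀ : Fin m) (c : ℂ)
    (φ : ∀ i, EuclideanSpace ℂ (Fin (d i))) (h : ‖c • tensor φ‖ = 1) :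
    IsProductState (c • tensor φ) := by
  have : c • tensor φ = tensor (fun i => (if i = i₀ then c else 1) • φ i) := by
    rw [tensor_smul, Finset.prod_ite_eq' Finset.univ i₀ fun _ => c]
    simp
  rw [this] at h ⊢
  exact isProductState_tensor _ h

/-- A vector that is a product across every cut `{i} | rest` is a product state. -/
theorem isProductState_of_forall_cut (i₀ : Fin m) {φ : Space d} (hφ : ‖φ‖ = 1)
    (hcut : ∀ i, ∀ x y : ∀ k, Fin (d k),
      φ x * φ y = φ (Function.update x i (y i)) * φ (Function.update y i (x i))) :
    IsProductState φ := by
  obtain ⟨z, hz⟩ : ∃ z, φ z ≠ 0 := by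
    by_contra! h
    have : φ = 0 := by ext x; exact h x
    simp [this] at hφ
  -- The candidate factors are the slices of `φ` through a point `z` where it does not vanish.
  -- Replacing the coordinates of `z` by those of `x` one party at a time multiplies `φ` by one
  -- factor each.
  let r : ∀ i, EuclideanSpace ℂ (Fin (d i)) := fun i =>
    WithLp.toLp 2 fun a => φ (Function.update z i a) / φ z
  have key : ∀ (x : ∀ k, Fin (d k)) (s : Finset (Fin m)),
      φ (s.piecewise x z) = φ z * ∏ i ∈ s, r i (x i) := by
    intro x s
    induction s using Finset.induction_on with
    | empty => simp
    | insert i s hi ih =>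
      have h1 := hcut i (s.piecewise x z) (Function.update z i (x i))
      have h2 : (s.piecewise x z) i = z i := by simp [hi]
      rw [Finset.prod_insert hi, Finset.piecewise_insert]
      simp only [Function.update_self, Function.update_idem, h2, Function.update_eq_self] at h1
      change _ = φ z * (φ (Function.update z i (x i)) / φ z * _)
      have h3 : φ (Function.update (s.piecewise x z) i (x i)) * φ z =
          φ (Function.update z i (x i)) * (φ z * ∏ i ∈ s, r i (x i)) := by
        rw [← h1, ih, mul_comm]
      refine mul_right_cancel₀ hz (h3.trans ?_)
      field_simp
  have : φ = φ z • tensor r := by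
    ext x
    have := key x Finset.univ
    rw [Finset.piecewise_univ] at this
    exact this
  rw [this] at hφ ⊢
  exact isProductState_smul_tensor i₀ _ _ hφ

end ProductVectors

/-! ### Overlap of PPT states with entangled vectors -/

section Overlap

/-- The sum of squares of `v ᵥ* M`. -/
def cutSq {α R : Type*} [Fintype α] [Fintype R] (M : α → R → ℂ) (v : α → ℂ) : ℝ :=
  ∑ r, ‖∑ a, v a * M a r‖ ^ 2

/-- Pythagoras: every column of `M` is split along the unit vector `star v`. The case `cutSq M v =
1` then forces `M` to have rank one. -/
theorem sum_norm_sub_sq_eq {α R : Type*} [Fintype α] [Fintype R] (M : α → R → ℂ) (v : α → ℂ)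
    (hM : ∑ a, ∑ r, ‖M a r‖ ^ 2 = 1) (hv : ∑ a, ‖v a‖ ^ 2 = 1) :
    ∑ a, ∑ r, ‖M a r - star (v a) * ∑ b, v b * M b r‖ ^ 2 = 1 - cutSq M v := by
  have h1 : ∀ r, ∑ a, ‖M a r - star (v a) * ∑ b, v b * M b r‖ ^ 2 =
      ∑ a, ‖M a r‖ ^ 2 - ‖∑ b, v b * M b r‖ ^ 2 := by
    intro r
    set P := ∑ b, v b * M b r with hP
    have hPc : ∑ a, star (v a) * star (M a r) = star P := by
      rw [hP, star_sum]; exact Finset.sum_congr rfl fun a _ => by rw [star_mul']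
    have hvC : ∑ a, v a * star (v a) = 1 := by
      have : ∀ a, v a * star (v a) = ((‖v a‖ ^ 2 : ℝ) : ℂ) := fun a => by
        rw [Complex.star_def, Complex.mul_conj']; push_cast; rfl
      rw [Finset.sum_congr rfl fun a _ => this a, ← Complex.ofReal_sum, hv, Complex.ofReal_one]
    have hn : ∀ z : ℂ, ((‖z‖ ^ 2 : ℝ) : ℂ) = z * star z := fun z => by
      rw [Complex.star_def, Complex.mul_conj']; push_cast; rfl
    apply Complex.ofReal_injective
    rw [Complex.ofReal_sub, Complex.ofReal_sum, Complex.ofReal_sum]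
    simp only [hn]
    have h2 : ∀ a, (M a r - star (v a) * P) * star (M a r - star (v a) * P) =
        M a r * star (M a r) - star P * (v a * M a r) - P * (star (v a) * star (M a r))
          + P * star P * (v a * star (v a)) := by
      intro a
      rw [star_sub, star_mul', star_star]
      ring
    rw [Finset.sum_congr rfl fun a _ => h2 a, Finset.sum_add_distrib, Finset.sum_sub_distrib,
      Finset.sum_sub_distrib, ← Finset.mul_sum, ← Finset.mul_sum, ← Finset.mul_sum, hPc, hvC, ← hP]
    ring
  rw [Finset.sum_comm, Finset.sum_congr rfl fun r _ => h1 r, Finset.sum_sub_distrib,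
    Finset.sum_comm, hM, cutSq]

theorem cutSq_smul {α R : Type*} [Fintype α] [Fintype R] (M : α → R → ℂ) (c : ℂ) (v : α → ℂ) :
    cutSq M (c • v) = ‖c‖ ^ 2 * cutSq M v := by
  simp only [cutSq, Pi.smul_apply, smul_eq_mul, mul_assoc, ← Finset.mul_sum, norm_mul, mul_pow]

/-- A unit vector of a bipartite system is either a product vector or has its squared Schmidt
coefficients bounded away from one. -/
theorem exists_cutSq_le {α R : Type*} [Fintype α] [Nonempty α] [Fintype R] (M : α → R → ℂ)
    (hM : ∑ a, ∑ r, ‖M a r‖ ^ 2 = 1) :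
    (∃ (f : α → ℂ) (g : R → ℂ), ∀ a r, M a r = f a * g r) ∨
      ∃ c : ℝ, c < 1 ∧ 0 ≤ c ∧ ∀ v : α → ℂ, cutSq M v ≤ c * ∑ a, ‖v a‖ ^ 2 := by
  have hcont : Continuous fun v : EuclideanSpace ℂ α => cutSq M v := by
    unfold cutSq; fun_prop
  have hne : (Metric.sphere (0 : EuclideanSpace ℂ α) 1).Nonempty :=
    NormedSpace.sphere_nonempty.mpr zero_le_one
  obtain ⟨v, hv, hmax⟩ := (isCompact_sphere (0 : EuclideanSpace ℂ α) 1).exists_isMaxOn hne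
    hcont.continuousOn
  have hv1 : ∑ a, ‖v a‖ ^ 2 = 1 := by
    rw [← EuclideanSpace.norm_sq_eq, mem_sphere_zero_iff_norm.mp hv, one_pow]
  -- The maximum over the compact unit sphere is the largest squared Schmidt coefficient. If it is
  -- below one it serves as `c`; otherwise the remainder in Pythagoras vanishes.
  by_cases h : cutSq M v < 1
  · right
    refine ⟨cutSq M v, h, Finset.sum_nonneg fun _ _ => sq_nonneg _, fun w => ?_⟩
    set w' : EuclideanSpace ℂ α := WithLp.toLp 2 w with hw'
    have hn : ∑ a, ‖w a‖ ^ 2 = ‖w'‖ ^ 2 := (EuclideanSpace.norm_sq_eq w').symm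
    by_cases h0 : w' = 0
    · have : w = 0 := by simpa [hw'] using h0
      subst this
      simp [cutSq]
    · have hpos : 0 < ‖w'‖ := norm_pos_iff.mpr h0
      have := hmax (a := ((‖w'‖⁻¹ : ℝ) : ℂ) • w') (by
        rw [mem_sphere_zero_iff_norm, norm_smul, Complex.norm_real, norm_inv, norm_norm,
          inv_mul_cancel₀ hpos.ne'])
      change cutSq M (((‖w'‖⁻¹ : ℝ) : ℂ) • w) ≤ cutSq M v at this
      rw [cutSq_smul, Complex.norm_real, norm_inv, norm_norm] at this
      rw [hn]
      rw [inv_pow, inv_mul_le_iff₀ (by positivity)] at this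
      linarith
  · left
    refine ⟨fun a => star (v a), fun r => ∑ b, v b * M b r, fun a r => ?_⟩
    have h2 := sum_norm_sub_sq_eq M v hM hv1
    have h3 : ∑ a, ∑ r, ‖M a r - star (v a) * ∑ b, v b * M b r‖ ^ 2 = 0 :=
      le_antisymm (by linarith) (Finset.sum_nonneg fun _ _ => Finset.sum_nonneg fun _ _ =>
        sq_nonneg _)
    have h4 := (Finset.sum_eq_zero_iff_of_nonneg fun _ _ => Finset.sum_nonneg fun _ _ =>
      sq_nonneg _).mp h3 a (Finset.mem_univ a)
    have h5 := (Finset.sum_eq_zero_iff_of_nonneg fun _ _ => sq_nonneg _).mp h4 r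
      (Finset.mem_univ r)
    exact sub_eq_zero.mp (norm_eq_zero.mp (pow_eq_zero_iff two_ne_zero |>.mp h5))

/-- The quadratic form of the partial transpose of `|M⟩⟨M|` is bounded by the largest squared
Schmidt coefficient. -/
theorem re_quadForm_le {α R : Type*} [Fintype α] [Fintype R] (M V : α → R → ℂ) {c : ℝ}
    (hc : ∀ v : α → ℂ, cutSq M v ≤ c * ∑ a, ‖v a‖ ^ 2) :
    (∑ p : (α × R) × (α × R), star (M p.2.1 p.1.2) * (star (V p.1.1 p.1.2) * V p.2.1 p.2.2) *
      M p.1.1 p.2.2).re ≤ c * ∑ p : α × R, ‖V p.1 p.2‖ ^ 2 := by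
  -- In terms of `Q` the form is `∑ star (Q s r) * Q r s`, which the inequality of arithmetic and
  -- geometric means bounds by `∑ ‖Q r s‖ ^ 2`. Each row of `Q` contributes a value of `cutSq M` at
  -- a conjugated column of `V`.
  set Q : R → R → ℂ := fun r s => ∑ a, star (V a r) * M a s with hQ
  have h1 : ∑ p : (α × R) × (α × R), star (M p.2.1 p.1.2) * (star (V p.1.1 p.1.2) *
      V p.2.1 p.2.2) * M p.1.1 p.2.2 = ∑ r, ∑ s, star (Q s r) * Q r s := by
    simp only [Fintype.sum_prod_type, hQ, star_sum, Finset.sum_mul_sum, star_mul', star_star]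
    rw [Finset.sum_comm]
    refine Finset.sum_congr rfl fun r _ => ?_
    rw [Finset.sum_congr rfl fun a _ => Finset.sum_comm, Finset.sum_comm]
    refine Finset.sum_congr rfl fun s _ => ?_
    rw [Finset.sum_comm]
    exact Finset.sum_congr rfl fun a _ => Finset.sum_congr rfl fun b _ => by ring
  have h2 : ∀ r s, (star (Q s r) * Q r s).re ≤ (‖Q s r‖ ^ 2 + ‖Q r s‖ ^ 2) / 2 := by
    intro r s
    refine (Complex.re_le_norm _).trans ?_
    rw [norm_mul, norm_star]
    nlinarith [sq_nonneg (‖Q s r‖ - ‖Q r s‖)]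
  have h3 : ∑ r, ∑ s, ‖Q r s‖ ^ 2 ≤ c * ∑ p : α × R, ‖V p.1 p.2‖ ^ 2 := by
    rw [Fintype.sum_prod_type_right, Finset.mul_sum]
    refine Finset.sum_le_sum fun r _ => ?_
    simpa [cutSq, hQ] using hc fun a => star (V a r)
  calc _ = ∑ r, ∑ s, (star (Q s r) * Q r s).re := by
        rw [h1, Complex.re_sum]; exact Finset.sum_congr rfl fun r _ => Complex.re_sum _ _
    _ ≤ ∑ r, ∑ s, (‖Q s r‖ ^ 2 + ‖Q r s‖ ^ 2) / 2 :=
        Finset.sum_le_sum fun r _ => Finset.sum_le_sum fun s _ => h2 r s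
    _ = ∑ r, ∑ s, ‖Q r s‖ ^ 2 := by
        simp only [← Finset.sum_div, Finset.sum_add_distrib]
        rw [Finset.sum_comm]
        ring
    _ ≤ _ := h3

variable {m : ℕ} {d : Fin m → ℕ}

/-- The coordinates of `φ` as a matrix with rows indexed by party `i`. -/
def cutMatrix (i : Fin m) (φ : Space d) (a : Fin (d i))
    (r : ∀ j : {j // j ≠ i}, Fin (d j)) : ℂ :=
  φ ((Equiv.piSplitAt i fun k => Fin (d k)).symm (a, r))

theorem apply_eq_cutMatrix (i : Fin m) (φ : Space d) (x : ∀ k, Fin (d k)) :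
    φ x = cutMatrix i φ (x i) fun j => x j := by
  exact congrArg φ ((Equiv.piSplitAt i fun k => Fin (d k)).symm_apply_apply x).symm

theorem update_piSplitAt_symm (i : Fin m) (a b : Fin (d i))
    (r : ∀ j : {j // j ≠ i}, Fin (d j)) :
    Function.update ((Equiv.piSplitAt i fun k => Fin (d k)).symm (a, r)) i b =
      (Equiv.piSplitAt i fun k => Fin (d k)).symm (b, r) := by
  funext k
  by_cases hk : k = i
  · subst hk; simp
  · simp [hk]

theorem piSplitAt_symm_self (i : Fin m) (a : Fin (d i)) (r : ∀ j : {j // j ≠ i}, Fin (d j)) :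
    (Equiv.piSplitAt i fun k => Fin (d k)).symm (a, r) i = a := by
  simp

theorem fidelity_eq_sum (φ : Space d) (σ : Op d) :
    fidelity φ σ = (∑ p : (∀ k, Fin (d k)) × (∀ k, Fin (d k)),
      star (φ p.1) * σ p.1 p.2 * φ p.2).re := by
  simp only [fidelity, dotProduct, Matrix.mulVec, Pi.star_apply, Finset.mul_sum,
    Fintype.sum_prod_type, mul_assoc]

/-- The partial transposition is moved from `σ` to the projector on `φ`. With `ptr i σ = Bᴴ * B`,
`re_quadForm_le` bounds the contribution of each row of `B`, and the squared row norms add up to the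
trace, since partial transposition fixes the diagonal. -/
theorem fidelity_le_of_posSemidef_ptr (i : Fin m) (φ : Space d) {c : ℝ}
    (hc : ∀ v : Fin (d i) → ℂ, cutSq (cutMatrix i φ) v ≤ c * ∑ a, ‖v a‖ ^ 2)
    {σ : Op d} (hσ : (ptr i σ).PosSemidef) : fidelity φ σ ≤ c * σ.trace.re := by
  obtain ⟨B, hB⟩ := exists_eq_conjTranspose_mul_self hσ
  have htr : σ.trace = ∑ k, ∑ x, star (B k x) * B k x := by
    have : σ.trace = (ptr i σ).trace := by
      simp [Matrix.trace, ptr_apply]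
    rw [this, hB, Finset.sum_comm]
    simp [Matrix.trace, Matrix.mul_apply]
  have htr' : σ.trace.re = ∑ k, ∑ x, ‖B k x‖ ^ 2 := by
    rw [htr, Complex.re_sum]
    refine Finset.sum_congr rfl fun k _ => ?_
    rw [Complex.re_sum]
    refine Finset.sum_congr rfl fun x _ => ?_
    rw [Complex.star_def, Complex.conj_mul']
    norm_cast
  have hsum : ∑ p : (∀ k, Fin (d k)) × (∀ k, Fin (d k)), star (φ p.1) * σ p.1 p.2 * φ p.2 =
      ∑ k, ∑ p : (∀ k, Fin (d k)) × (∀ k, Fin (d k)), star (φ (swapAt d i p).1) *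
        (star (B k p.1) * B k p.2) * φ (swapAt d i p).2 := by
    rw [Finset.sum_comm, ← Equiv.sum_comp (swapAt d i)]
    refine Finset.sum_congr rfl fun p _ => ?_
    have : σ (swapAt d i p).1 (swapAt d i p).2 = ∑ k, star (B k p.1) * B k p.2 := by
      have h := congrFun (congrFun hB p.1) p.2
      rwa [Matrix.mul_apply] at h
    rw [this, Finset.mul_sum, Finset.sum_mul]
  rw [fidelity_eq_sum, hsum, Complex.re_sum, htr', Finset.mul_sum]
  refine Finset.sum_le_sum fun k _ => ?_
  set E := Equiv.piSplitAt i fun k => Fin (d k) with hE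
  have h := re_quadForm_le (cutMatrix i φ) (fun a r => B k (E.symm (a, r))) hc
  rw [Equiv.sum_comp E.symm fun x => ‖B k x‖ ^ 2] at h
  refine le_trans (le_of_eq ?_) h
  rw [← Equiv.sum_comp (Equiv.prodCongr E.symm E.symm)]
  congr 1
  refine Finset.sum_congr rfl fun p _ => ?_
  obtain ⟨⟨a, r⟩, b, s⟩ := p
  simp only [Equiv.prodCongr_apply, Prod.map, swapAt_apply, hE, piSplitAt_symm_self,
    update_piSplitAt_symm, cutMatrix]

/-- PPT states are not distillable. -/
theorem not_isDistillable_of_posSemidef_ptr (i₀ : Fin m) {ρ : Op d}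
    (hρ : ∀ i, (ptr i ρ).PosSemidef) (htr : ρ.trace = 1) : ¬ IsDistillable ρ := by
  rintro ⟨e, φ, hφ, hprod, hdist⟩
  have hM : ∀ i, ∑ a, ∑ r, ‖cutMatrix i φ a r‖ ^ 2 = 1 := by
    intro i
    rw [← Fintype.sum_prod_type']
    simp only [cutMatrix, Prod.mk.eta]
    rw [Equiv.sum_comp (Equiv.piSplitAt i fun k => Fin (e k)).symm fun x => ‖φ x‖ ^ 2,
      ← EuclideanSpace.norm_sq_eq, hφ, one_pow]
  have hne : ∀ i, Nonempty (Fin (e i)) := by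
    intro i
    by_contra h
    rw [not_nonempty_iff] at h
    simpa using hM i
  obtain ⟨i, c, hc1, hc0, hc⟩ : ∃ (i : Fin m) (c : ℝ), c < 1 ∧ 0 ≤ c ∧
      ∀ v : Fin (e i) → ℂ, cutSq (cutMatrix i φ) v ≤ c * ∑ a, ‖v a‖ ^ 2 := by
    by_contra hcon
    refine hprod (isProductState_of_forall_cut i₀ hφ fun i x y => ?_)
    have := hne i
    rcases exists_cutSq_le (cutMatrix i φ) (hM i) with ⟨f, g, hfg⟩ | h
    · have hu : ∀ (x : ∀ k, Fin (e k)) (b : Fin (e i)),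
          (fun j : {j // j ≠ i} => Function.update x i b j) = fun j : {j // j ≠ i} => x j :=
        fun x b => funext fun j : {j // j ≠ i} => Function.update_of_ne j.2 _ _
      rw [apply_eq_cutMatrix i φ x, apply_eq_cutMatrix i φ y, apply_eq_cutMatrix i φ
        (Function.update x i (y i)), apply_eq_cutMatrix i φ (Function.update y i (x i)),
        hu, hu]
      simp only [Function.update_self, hfg]
      ring
    · exact absurd ⟨i, h⟩ hcon
  -- Any positive tolerance below `1 - c` contradicts the bound `c` on the fidelity.
  obtain ⟨n, T, hT, hle⟩ := hdist ((1 - c) / 2) (by linarith)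
  have h1 : (ptr i (T (tensorPow ρ n))).PosSemidef := by
    refine hT.posSemidef_ptr i _ ?_
    rw [ptr_tensorPow]
    exact posSemidef_tensorPow (hρ i) n
  have h2 := fidelity_le_of_posSemidef_ptr i φ hc h1
  rw [hT.trace_eq, trace_tensorPow, htr, one_pow, Complex.one_re] at h2
  linarith

end Overlap

/-! ### Complementary states of product bases -/

section ComplementaryState

variable {m : ℕ} {d : Fin m → ℕ}

theorem proj_mul_proj (ψ χ : Space d) :
    proj ψ * proj χ = inner ℂ ψ χ • Matrix.vecMulVec ψ.ofLp (star χ.ofLp) := by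
  ext x y
  rw [proj, proj, Matrix.vecMulVec_mul_vecMulVec, EuclideanSpace.inner_eq_star_dotProduct,
    dotProduct_comm]
  simp [Matrix.vecMulVec_apply]
  ring

theorem proj_conjTranspose (ψ : Space d) : (proj ψ)ᴴ = proj ψ := by
  ext x y
  simp [proj_apply, mul_comm]

theorem proj_mulVec (ψ χ : Space d) :
    (proj ψ).mulVec χ.ofLp = (inner ℂ ψ χ • ψ : Space d).ofLp := by
  funext x
  simp only [Matrix.mulVec, dotProduct, proj_apply, PiLp.inner_apply, RCLike.inner_apply,
    PiLp.smul_apply, smul_eq_mul, Finset.sum_mul]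
  exact Finset.sum_congr rfl fun y _ => by rw [starRingEnd_apply]; ring

theorem trace_proj (ψ : Space d) : (proj ψ).trace = (‖ψ‖ : ℂ) ^ 2 := by
  rw [proj, Matrix.trace_vecMulVec, ← EuclideanSpace.inner_eq_star_dotProduct,
    inner_self_eq_norm_sq_to_K]
  rfl

/-- The operator is a self-adjoint idempotent, hence of the form `Aᴴ * A` with `A` itself. -/
theorem posSemidef_one_sub_sum_proj {ι : Type*} [Fintype ι] {ψ : ι → Space d}
    (hψ : Orthonormal ℂ ψ) : (1 - ∑ k, proj (ψ k)).PosSemidef := by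
  classical
  set Q := ∑ k, proj (ψ k) with hQ
  have hQQ : Q * Q = Q := by
    rw [hQ, Finset.sum_mul_sum]
    refine Finset.sum_congr rfl fun k _ => ?_
    rw [Finset.sum_eq_single k]
    · rw [proj_mul_proj, orthonormal_iff_ite.mp hψ, if_pos rfl, one_smul, proj]
    · intro l _ hl
      rw [proj_mul_proj, orthonormal_iff_ite.mp hψ, if_neg hl.symm, zero_smul]
    · simp
  have hQH : Qᴴ = Q := by
    rw [hQ, Matrix.conjTranspose_sum]
    exact Finset.sum_congr rfl fun k _ => proj_conjTranspose _
  have : (1 - Q) = (1 - Q)ᴴ * (1 - Q) := by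
    rw [Matrix.conjTranspose_sub, Matrix.conjTranspose_one, hQH, Matrix.mul_sub, Matrix.mul_one,
      Matrix.sub_mul, Matrix.one_mul, hQQ, sub_self, sub_zero]
  rw [this]
  exact Matrix.posSemidef_conjTranspose_mul_self _

theorem IsPB.orthonormal {S : Finset (Space d)} (hS : IsPB S) :
    Orthonormal ℂ (fun s : S => (s : Space d)) :=
  ⟨fun s => (hS.1 s s.2).norm_eq_one, fun s t hst =>
    hS.2 s s.2 t t.2 fun h => hst (Subtype.ext h)⟩

theorem mem_compl {S : Finset (Space d)} {χ : Space d} :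
    χ ∈ compl S ↔ ∀ ψ ∈ S, inner ℂ ψ χ = 0 := by
  rw [compl, Submodule.mem_orthogonal]
  refine ⟨fun h ψ hψ => h ψ (Submodule.subset_span hψ), fun h u hu => ?_⟩
  induction hu using Submodule.span_induction with
  | mem x hx => exact h x hx
  | zero => simp
  | add x y _ _ hx hy => rw [inner_add_left, hx, hy, add_zero]
  | smul a x _ hx => rw [inner_smul_left, hx, mul_zero]

theorem finrank_space (d : Fin m → ℕ) : Module.finrank ℂ (Space d) = ∏ i, d i := by
  simp

theorem IsPB.card_add_finrank_compl {S : Finset (Space d)} (hS : IsPB S) :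
    S.card + Module.finrank ℂ (compl S) = ∏ i, d i := by
  rw [← finrank_space d,
    ← Submodule.finrank_add_finrank_orthogonal (Submodule.span ℂ (S : Set (Space d))), compl]
  congr 1
  exact (finrank_span_finset_eq_card hS.orthonormal.linearIndependent).symm

/-- The operator `1 - ∑ |ψ⟩⟨ψ|`. -/
def complProj (S : Finset (Space d)) : Op d := 1 - ∑ ψ ∈ S, proj ψ

theorem complState_eq (S : Finset (Space d)) :
    complState S = ((∏ i, (d i : ℂ)) - (S.card : ℂ))⁻¹ • complProj S := rfl

theorem complProj_mulVec (S : Finset (Space d)) (χ : Space d) :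
    (complProj S).mulVec χ.ofLp = (χ - ∑ ψ ∈ S, inner ℂ ψ χ • ψ : Space d).ofLp := by
  rw [complProj, Matrix.sub_mulVec, Matrix.one_mulVec, Matrix.sum_mulVec, WithLp.ofLp_sub,
    WithLp.ofLp_sum]
  congr 1
  exact Finset.sum_congr rfl fun ψ _ => proj_mulVec ψ χ

theorem IsPB.complProj_mulVec_mem {S : Finset (Space d)} (hS : IsPB S) (χ : Space d) :
    χ - ∑ ψ ∈ S, inner ℂ ψ χ • ψ ∈ compl S := by
  refine mem_compl.mpr fun φ hφ => ?_
  rw [inner_sub_right, inner_sum, Finset.sum_eq_single φ]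
  · rw [inner_smul_right, inner_self_eq_norm_sq_to_K, (hS.1 φ hφ).norm_eq_one]
    simp
  · intro ψ hψ hne
    rw [inner_smul_right, hS.2 φ hφ ψ hψ hne.symm, mul_zero]
  · exact fun h => absurd hφ h

theorem complProj_mulVec_of_mem {S : Finset (Space d)} {χ : Space d} (hχ : χ ∈ compl S) :
    (complProj S).mulVec χ.ofLp = χ.ofLp := by
  rw [complProj_mulVec, Finset.sum_eq_zero, sub_zero]
  intro ψ hψ
  rw [mem_compl.mp hχ ψ hψ, zero_smul]

theorem normalization_eq {S : Finset (Space d)} :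
    (∏ i, (d i : ℂ)) - (S.card : ℂ) = (((∏ i, d i : ℕ) : ℝ) - (S.card : ℝ) : ℝ) := by
  push_cast; rfl

theorem normalization_inv_nonneg {S : Finset (Space d)} (hS : IsPB S) :
    (0 : ℝ) ≤ (((∏ i, d i : ℕ) : ℝ) - (S.card : ℝ))⁻¹ := by
  have h : (S.card : ℝ) ≤ (∏ i, d i : ℕ) := by
    exact_mod_cast (Nat.le_add_right _ _).trans hS.card_add_finrank_compl.le
  exact inv_nonneg.mpr (sub_nonneg.mpr h)

theorem normalization_ne_zero {S : Finset (Space d)} (h : S.card < ∏ i, d i) :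
    (∏ i, (d i : ℂ)) - (S.card : ℂ) ≠ 0 := by
  rw [normalization_eq]
  have : (S.card : ℝ) < (∏ i, d i : ℕ) := by exact_mod_cast h
  exact_mod_cast (sub_pos.mpr this).ne'

theorem posSemidef_smul_complState {S : Finset (Space d)} (hS : IsPB S) {A : Op d}
    (hA : A.PosSemidef) : (((∏ i, (d i : ℂ)) - (S.card : ℂ))⁻¹ • A).PosSemidef := by
  rw [normalization_eq, ← Complex.ofReal_inv]
  exact hA.smul (by exact_mod_cast normalization_inv_nonneg hS)

theorem IsPB.isDensity_complState {S : Finset (Space d)} (hS : IsPB S)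
    (hcard : S.card < ∏ i, d i) : IsDensity (complState S) := by
  refine ⟨?_, ?_⟩
  · refine posSemidef_smul_complState hS ?_
    rw [← Finset.sum_coe_sort S]
    exact posSemidef_one_sub_sum_proj hS.orthonormal
  · rw [complState, Matrix.trace_smul, Matrix.trace_sub, Matrix.trace_one, Matrix.trace_sum,
      Finset.sum_congr rfl fun ψ hψ => by rw [trace_proj, (hS.1 ψ hψ).norm_eq_one]]
    simp only [Fintype.card_pi, Fintype.card_fin, Nat.cast_prod, Complex.ofReal_one, one_pow,
      Finset.sum_const, nsmul_eq_mul, mul_one, smul_eq_mul]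
    exact inv_mul_cancel₀ (normalization_ne_zero hcard)

theorem inner_conjVec {n : ℕ} (v w : EuclideanSpace ℂ (Fin n)) :
    inner ℂ (conjVec v) (conjVec w) = star (inner ℂ v w) := by
  simp [PiLp.inner_apply, conjVec, mul_comm]

/-- Inner products of product vectors factorize, and conjugating the vectors of party `i` only
conjugates one factor. Vanishing products still vanish, so the partially transposed projectors again
belong to an orthonormal family. -/
theorem IsPB.posSemidef_ptr_complState {S : Finset (Space d)} (hS : IsPB S) (i : Fin m) :
    (ptr i (complState S)).PosSemidef := by
  choose φ hφ hφS using fun s : S => hS.1 s s.2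
  have hinner : ∀ s t : S, inner ℂ (tensor (Function.update (φ s) i (conjVec (φ s i))))
      (tensor (Function.update (φ t) i (conjVec (φ t i)))) =
      star (inner ℂ (φ s i) (φ t i)) * ∏ k ∈ Finset.univ.erase i, inner ℂ (φ s k) (φ t k) := by
    intro s t
    rw [inner_tensor, ← Finset.mul_prod_erase _ _ (Finset.mem_univ i)]
    congr 1
    · rw [Function.update_self, Function.update_self, inner_conjVec]
    · refine Finset.prod_congr rfl fun k hk => ?_
      rw [Function.update_of_ne (Finset.ne_of_mem_erase hk),
        Function.update_of_ne (Finset.ne_of_mem_erase hk)]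
  have hon : Orthonormal ℂ
      fun s : S => tensor (Function.update (φ s) i (conjVec (φ s i))) := by
    classical
    rw [orthonormal_iff_ite]
    intro s t
    rw [hinner]
    have h := orthonormal_iff_ite.mp hS.orthonormal s t
    simp only [hφS, inner_tensor] at h
    rw [← Finset.mul_prod_erase _ _ (Finset.mem_univ i)] at h
    split_ifs at h ⊢ with hst
    · subst hst
      rw [← h, inner_self_eq_norm_sq_to_K, hφ]
      simp
    · rcases mul_eq_zero.mp h with h | h
      · rw [h, star_zero, zero_mul]
      · rw [h, mul_zero]
  rw [complState, ptr_smul, ptr_sub, ptr_one, ptr_sum]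
  refine posSemidef_smul_complState hS ?_
  rw [← Finset.sum_coe_sort S]
  simp only [hφS, ptr_proj_tensor]
  exact posSemidef_one_sub_sum_proj hon

/-- The complementary state of a PB, if entangled, is bound entangled. -/
theorem IsPB.isBoundEntangled_complState {S : Finset (Space d)} (hS : IsPB S) (i₀ : Fin m)
    (hcard : S.card < ∏ i, d i) (hsep : ¬ IsSeparable (complState S)) :
    IsBoundEntangled (complState S) :=
  have hd := hS.isDensity_complState hcard
  ⟨hd, hsep, not_isDistillable_of_posSemidef_ptr i₀ hS.posSemidef_ptr_complState hd.2⟩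

theorem IsPB.range_complState {S : Finset (Space d)} (hS : IsPB S)
    (hcard : S.card < ∏ i, d i) :
    LinearMap.range (Matrix.toEuclideanLin (complState S)) = compl S := by
  have hne := normalization_ne_zero hcard
  apply le_antisymm
  · rintro _ ⟨χ, rfl⟩
    have : Matrix.toEuclideanLin (complState S) χ =
        ((∏ i, (d i : ℂ)) - (S.card : ℂ))⁻¹ • (χ - ∑ ψ ∈ S, inner ℂ ψ χ • ψ) := by
      rw [Matrix.toLpLin_apply, complState_eq, Matrix.smul_mulVec, complProj_mulVec]
      rfl
    rw [this]
    exact Submodule.smul_mem _ _ (hS.complProj_mulVec_mem χ)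
  · intro χ hχ
    refine ⟨((∏ i, (d i : ℂ)) - (S.card : ℂ)) • χ, ?_⟩
    rw [Matrix.toLpLin_apply, complState_eq, Matrix.smul_mulVec, WithLp.ofLp_smul,
      Matrix.mulVec_smul, complProj_mulVec_of_mem hχ, smul_smul, inv_mul_cancel₀ hne, one_smul]

theorem IsPB.rank_complState {S : Finset (Space d)} (hS : IsPB S)
    (hcard : S.card < ∏ i, d i) :
    (complState S).rank = Module.finrank ℂ (compl S) := by
  rw [← hS.range_complState hcard, Matrix.toEuclideanLin, Matrix.toLpLin_eq_toLin,
    ← Matrix.rank_eq_finrank_range_toLin]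

/-- If the product states of the complementary subspace span less than that subspace, then the
complementary state is entangled. -/
theorem IsPB.not_isSeparable_complState {S : Finset (Space d)} (hS : IsPB S)
    (K : Submodule ℂ (Space d)) (hK : ∀ ψ ∈ compl S, IsProductState ψ → ψ ∈ K)
    (hrank : Module.finrank ℂ K < Module.finrank ℂ (compl S)) :
    ¬ IsSeparable (complState S) := by
  rintro ⟨N, p, ψ, hp, hψ, hρ⟩
  have hcard : S.card < ∏ i, d i := by
    have := hS.card_add_finrank_compl
    omega
  have hact : ∀ χ : Space d, Matrix.toEuclideanLin (complState S) χ =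
      ∑ k, (p k : ℂ) • inner ℂ (ψ k) χ • ψ k := by
    intro χ
    rw [Matrix.toLpLin_apply, hρ, Matrix.sum_mulVec]
    simp only [Matrix.smul_mulVec, proj_mulVec]
    ext x
    simp
  -- For `χ ∈ S` the expectation `⟨χ|ρ|χ⟩ = ∑ p k * ‖⟨χ, ψ k⟩‖ ^ 2` is zero and its terms are
  -- nonnegative, so each `ψ k` of nonzero weight is orthogonal to `χ`.
  have hmem : ∀ k, p k ≠ 0 → ψ k ∈ compl S := by
    intro k hk
    refine mem_compl.mpr fun χ hχ => ?_
    have h0 : Matrix.toEuclideanLin (complState S) χ = 0 := by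
      rw [Matrix.toLpLin_apply, complState_eq, Matrix.smul_mulVec, complProj_mulVec,
        Finset.sum_eq_single χ, inner_self_eq_norm_sq_to_K, (hS.1 χ hχ).norm_eq_one]
      · simp
      · intro φ hφ hne
        rw [hS.2 φ hφ χ hχ hne, zero_smul]
      · exact fun h => absurd hχ h
    have h1 : ∑ k, p k * ‖inner ℂ χ (ψ k)‖ ^ 2 = 0 := by
      have h2 : inner ℂ χ (Matrix.toEuclideanLin (complState S) χ) = 0 := by
        rw [h0, inner_zero_right]
      rw [hact, inner_sum] at h2
      have h3 : ∀ k, inner ℂ χ ((p k : ℂ) • inner ℂ (ψ k) χ • ψ k) =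
          ((p k * ‖inner ℂ χ (ψ k)‖ ^ 2 : ℝ) : ℂ) := by
        intro k
        rw [inner_smul_right, inner_smul_right, ← inner_conj_symm (ψ k) χ, Complex.conj_mul']
        push_cast; rfl
      rw [Finset.sum_congr rfl fun k _ => h3 k, ← Complex.ofReal_sum] at h2
      exact_mod_cast h2
    have h4 := (Finset.sum_eq_zero_iff_of_nonneg fun k _ =>
      mul_nonneg (hp k) (sq_nonneg _)).mp h1 k (Finset.mem_univ k)
    simpa [hk] using h4
  have hle : compl S ≤ K := by
    rw [← hS.range_complState hcard]
    rintro _ ⟨χ, rfl⟩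
    rw [hact]
    refine Submodule.sum_mem _ fun k _ => ?_
    by_cases hk : p k = 0
    · simp [hk]
    · exact K.smul_mem _ (K.smul_mem _ (hK _ (hmem k hk) (hψ k)))
  exact absurd (Submodule.finrank_mono hle) (not_le.mpr hrank)

end ComplementaryState

/-! ### Extending an uncompletable product basis -/

section Extension

variable {m : ℕ} {d : Fin m → ℕ}

open Classical in
theorem IsPB.union {S T : Finset (Space d)} (hS : IsPB S) (hT : IsPB T)
    (hST : ∀ ψ ∈ S, ∀ χ ∈ T, inner ℂ ψ χ = 0) : IsPB (S ∪ T) := by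
  refine ⟨fun ψ hψ => (Finset.mem_union.mp hψ).elim (hS.1 ψ) (hT.1 ψ), fun ψ hψ χ hχ hne => ?_⟩
  rcases Finset.mem_union.mp hψ with h | h <;> rcases Finset.mem_union.mp hχ with h' | h'
  · exact hS.2 ψ h χ h' hne
  · exact hST ψ h χ h'
  · exact inner_eq_zero_symm.mp (hST χ h' ψ h)
  · exact hT.2 ψ h χ h' hne

open Classical in
theorem card_union_of_orthogonal {S T : Finset (Space d)} (hS : IsPB S)
    (hST : ∀ ψ ∈ S, ∀ χ ∈ T, inner ℂ ψ χ = 0) : (S ∪ T).card = S.card + T.card := by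
  refine Finset.card_union_of_disjoint (Finset.disjoint_left.mpr fun ψ hψ hψ' => ?_)
  exact (hS.1 ψ hψ).ne_zero (inner_self_eq_zero.mp (hST ψ hψ ψ hψ'))

theorem isPB_empty : IsPB (∅ : Finset (Space d)) := by simp [IsPB]

open Classical in
/-- Every uncompletable product basis can be extended to one with a bound entangled
complementary state. -/
theorem IsUCPB.exists_isBoundEntangled {S : Finset (Space d)} (hS : IsUCPB S) :
    ∃ T : Finset (Space d), IsPB T ∧ (∀ ψ ∈ S, ∀ χ ∈ T, inner ℂ ψ χ = 0) ∧
      IsBoundEntangled (complState (S ∪ T)) := by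
  let P : ℕ → Prop := fun n => ∃ T : Finset (Space d), IsPB T ∧
    (∀ ψ ∈ S, ∀ χ ∈ T, inner ℂ ψ χ = 0) ∧ T.card = n
  have hlt : ∀ T : Finset (Space d), IsPB T → (∀ ψ ∈ S, ∀ χ ∈ T, inner ℂ ψ χ = 0) →
      T.card < Module.finrank ℂ (compl S) := fun T hT hST =>
    hS.2 T hT fun χ hχ => mem_compl.mpr fun ψ hψ => hST ψ hψ χ hχ
  have h0 : P 0 := ⟨∅, isPB_empty, by simp, rfl⟩
  -- An orthogonal extension `T` of largest cardinality is chosen; uncompletability bounds these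
  -- cardinalities.
  have hmax := Nat.findGreatest_spec (P := P) (Nat.zero_le (Module.finrank ℂ (compl S))) h0
  obtain ⟨T, hT, hST, hTn⟩ := hmax
  have hU := hS.1.union hT hST
  have hUcard := card_union_of_orthogonal hS.1 hST
  have hdim := hS.1.card_add_finrank_compl
  have hTlt := hlt T hT hST
  have hno : ∀ ψ ∈ compl (S ∪ T), ¬ IsProductState ψ := by
    intro ψ hψ hprod
    have hψ' := mem_compl.mp hψ
    have hψT : ψ ∉ T := fun h =>
      hprod.ne_zero (inner_self_eq_zero.mp (hψ' ψ (Finset.mem_union_right _ h)))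
    have h1 : IsPB (T ∪ {ψ}) := by
      refine hT.union ⟨?_, ?_⟩ ?_
      · simpa using hprod
      · simp +contextual
      · simpa using fun χ hχ => hψ' χ (Finset.mem_union_right _ hχ)
    have h2 : ∀ φ ∈ S, ∀ χ ∈ T ∪ {ψ}, inner ℂ φ χ = 0 := by
      intro φ hφ χ hχ
      rcases Finset.mem_union.mp hχ with h | h
      · exact hST φ hφ χ h
      · rw [Finset.mem_singleton.mp h]
        exact hψ' φ (Finset.mem_union_left _ hφ)
    have h3 : (T ∪ {ψ}).card = T.card + 1 := by
      rw [Finset.card_union_of_disjoint (by simpa using hψT), Finset.card_singleton]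
    have h4 := Nat.le_findGreatest (P := P) (hlt _ h1 h2).le ⟨_, h1, h2, rfl⟩
    omega
  -- Without parties the space is one-dimensional, so `S` and `T` are empty and the complement
  -- contains the empty product, against maximality.
  have hi : Nonempty (Fin m) := by
    by_contra hm
    rw [not_nonempty_iff] at hm
    have h1 : IsProductState (tensor fun i : Fin m => (hm.elim i : EuclideanSpace ℂ (Fin (d i)))) :=
      ⟨_, fun i => hm.elim i, rfl⟩
    have h2 := hU.card_add_finrank_compl
    rw [Finset.univ_eq_empty, Finset.prod_empty] at h2 hdim
    have hS0 : S = ∅ := by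
      rw [← Finset.card_eq_zero]; omega
    have hT0 : T = ∅ := by
      rw [← Finset.card_eq_zero]; omega
    refine hno _ ?_ h1
    simp [hS0, hT0, compl]
  refine ⟨T, hT, hST, hU.isBoundEntangled_complState hi.some (by omega)
    (hU.not_isSeparable_complState ⊥ (fun ψ hψ h => absurd h (hno ψ hψ)) ?_)⟩
  have := hU.card_add_finrank_compl
  rw [finrank_bot]
  omega

end Extension

/-! ### Local extensions -/

section LocalExtension

variable {m : ℕ} {d e : Fin m → ℕ}

/-- The inclusion of index sets of a local extension. -/
def indexIncl (h : ∀ i, d i ≤ e i) (x : ∀ i, Fin (d i)) : ∀ i, Fin (e i) :=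
  fun i => Fin.castLE (h i) (x i)

theorem indexIncl_injective (h : ∀ i, d i ≤ e i) : Function.Injective (indexIncl h) :=
  fun _ _ hxy => funext fun i => Fin.castLE_injective (h i) (congrFun hxy i)

theorem embed_indexIncl (h : ∀ i, d i ≤ e i) (ψ : Space d) (x : ∀ i, Fin (d i)) :
    embed e ψ (indexIncl h x) = ψ x := by
  have hx : ∀ i, (indexIncl h x i : ℕ) < d i := fun i => (x i).2
  change (if hx : ∀ i, (indexIncl h x i : ℕ) < d i then _ else _) = _
  rw [dif_pos hx]
  rfl

theorem embed_of_not_mem_range (h : ∀ i, d i ≤ e i) (ψ : Space d) (y : ∀ i, Fin (e i))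
    (hy : y ∉ Set.range (indexIncl h)) : embed e ψ y = 0 := by
  change (if hx : ∀ i, (y i : ℕ) < d i then _ else _) = _
  rw [dif_neg]
  exact fun hx => hy ⟨fun i => ⟨y i, hx i⟩, rfl⟩

theorem inner_embed (h : ∀ i, d i ≤ e i) (ψ χ : Space d) :
    inner ℂ (embed e ψ) (embed e χ) = inner ℂ ψ χ := by
  classical
  simp only [PiLp.inner_apply]
  symm
  refine Finset.sum_of_injOn (indexIncl h) (indexIncl_injective h).injOn (by simp) ?_ ?_
  · intro y _ hy
    rw [embed_of_not_mem_range h ψ y (by simpa using hy), inner_zero_left]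
  · intro x _
    rw [embed_indexIncl, embed_indexIncl]

theorem embed_injective (h : ∀ i, d i ≤ e i) : Function.Injective (embed (d := d) e) := by
  intro ψ χ hψ
  ext x
  rw [← embed_indexIncl h ψ, hψ, embed_indexIncl]

/-- Extension by zero of the vectors of one party. -/
def embedVec {a : ℕ} (b : ℕ) (v : EuclideanSpace ℂ (Fin a)) : EuclideanSpace ℂ (Fin b) :=
  WithLp.toLp 2 fun x => if hx : (x : ℕ) < a then v ⟨x, hx⟩ else 0

theorem embed_tensor (φ : ∀ i, EuclideanSpace ℂ (Fin (d i))) :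
    embed e (tensor φ) = tensor fun i => embedVec (e i) (φ i) := by
  ext x
  change (if hx : ∀ i, (x i : ℕ) < d i then _ else _) =
    ∏ i, if hx : (x i : ℕ) < d i then φ i ⟨x i, hx⟩ else 0
  split_ifs with hx
  · change ∏ i, φ i ⟨x i, hx i⟩ = _
    exact Finset.prod_congr rfl fun i _ => by rw [dif_pos (hx i)]
  · push Not at hx
    obtain ⟨i, hi⟩ := hx
    exact (Finset.prod_eq_zero (Finset.mem_univ i) (dif_neg (not_lt.mpr hi))).symm

theorem norm_embed (h : ∀ i, d i ≤ e i) (ψ : Space d) : ‖embed e ψ‖ = ‖ψ‖ := by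
  rw [@norm_eq_sqrt_re_inner ℂ, @norm_eq_sqrt_re_inner ℂ _ _ _ _ ψ, inner_embed h]

theorem IsProductState.embed_of_le (h : ∀ i, d i ≤ e i) {ψ : Space d} (hψ : IsProductState ψ) :
    IsProductState (embed e ψ) := by
  have hn := norm_embed h ψ
  rw [hψ.norm_eq_one] at hn
  obtain ⟨φ, hφ, rfl⟩ := hψ
  rw [embed_tensor] at hn ⊢
  exact isProductState_tensor _ hn

open Classical in
theorem IsPB.image_embed (h : ∀ i, d i ≤ e i) {S : Finset (Space d)} (hS : IsPB S) :
    IsPB (S.image (embed e)) := by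
  refine ⟨fun ψ hψ => ?_, fun ψ hψ χ hχ hne => ?_⟩
  · obtain ⟨ψ', hψ', rfl⟩ := Finset.mem_image.mp hψ
    exact (hS.1 ψ' hψ').embed_of_le h
  · obtain ⟨ψ', hψ', rfl⟩ := Finset.mem_image.mp hψ
    obtain ⟨χ', hχ', rfl⟩ := Finset.mem_image.mp hχ
    rw [inner_embed h]
    exact hS.2 ψ' hψ' χ' hχ' fun h => hne (by rw [h])

theorem proj_smul (c : ℂ) (ψ : Space d) : proj (c • ψ) = ((‖c‖ ^ 2 : ℝ) : ℂ) • proj ψ := by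
  ext x y
  have : ((‖c‖ ^ 2 : ℝ) : ℂ) = c * star c := by
    rw [Complex.star_def, Complex.mul_conj']; push_cast; rfl
  simp only [proj_apply, PiLp.smul_apply, smul_eq_mul, star_mul', Matrix.smul_apply, this]
  ring

theorem exists_proj_tensor_eq (hd : ∀ i, 0 < d i) (φ : ∀ i, EuclideanSpace ℂ (Fin (d i))) :
    ∃ (p : ℝ) (ψ : Space d), 0 ≤ p ∧ IsProductState ψ ∧ proj (tensor φ) = (p : ℂ) • proj ψ := by
  have : ∀ i, ∃ (c : ℂ) (v : EuclideanSpace ℂ (Fin (d i))), ‖v‖ = 1 ∧ φ i = c • v := by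
    intro i
    by_cases h : φ i = 0
    -- A zero factor gets coefficient zero and an arbitrary unit vector, which exists because the
    -- local dimension is positive.
    · exact ⟨0, EuclideanSpace.single ⟨0, hd i⟩ 1, by simp, by simp [h]⟩
    · have hn : ‖φ i‖ ≠ 0 := norm_ne_zero_iff.mpr h
      refine ⟨(‖φ i‖ : ℂ), ((‖φ i‖⁻¹ : ℝ) : ℂ) • φ i, ?_, ?_⟩
      · rw [norm_smul, Complex.norm_real, norm_inv, norm_norm, inv_mul_cancel₀ hn]
      · rw [smul_smul, ← Complex.ofReal_mul, mul_inv_cancel₀ hn, Complex.ofReal_one, one_smul]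
  choose c v hv hφ using this
  refine ⟨‖∏ i, c i‖ ^ 2, tensor v, sq_nonneg _, ⟨v, hv, rfl⟩, ?_⟩
  rw [show φ = fun i => c i • v i from funext hφ, tensor_smul, proj_smul]

theorem isSeparable_of_eq_sum_tensor (hd : ∀ i, 0 < d i) {ι : Type*} [Fintype ι] {c : ℝ}
    (hc : 0 ≤ c) (φ : ι → ∀ i, EuclideanSpace ℂ (Fin (d i))) :
    IsSeparable ((c : ℂ) • ∑ k, proj (tensor (φ k))) := by
  choose p ψ hp hψ h using fun k => exists_proj_tensor_eq hd (φ k)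
  let E := Fintype.equivFin ι
  refine ⟨Fintype.card ι, fun k => c * p (E.symm k), fun k => ψ (E.symm k),
    fun k => mul_nonneg hc (hp _), fun k => hψ _, ?_⟩
  rw [Equiv.sum_comp E.symm fun k => ((c * p k : ℝ) : ℂ) • proj (ψ k), Finset.smul_sum]
  refine Finset.sum_congr rfl fun k _ => ?_
  rw [h, smul_smul]
  push_cast; rfl

open Classical in
/-- A product basis with entangled complementary state is strongly uncompletable. -/
theorem IsPB.isSUCPB_of_not_isSeparable {S : Finset (Space d)} (hS : IsPB S)
    (hsep : ¬ IsSeparable (complState S)) : IsSUCPB S := by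
  refine ⟨hS, fun e he => ⟨hS.image_embed he, fun T hT hTS => ?_⟩⟩
  by_contra! hcard
  -- If a local dimension vanishes there are no coordinates, and the state equals the empty
  -- separable sum.
  have hd : ∀ i, 0 < d i := by
    by_contra! h
    obtain ⟨i, hi⟩ := h
    refine hsep ⟨0, fun _ => 0, fun _ => 0, fun k => k.elim0, fun k => k.elim0, ?_⟩
    ext x
    exact (by simpa [Nat.le_zero.mp hi] using x i : Fin 0).elim0
  have hS' := hS.image_embed he
  have hST : ∀ ψ ∈ S.image (embed e), ∀ χ ∈ T, inner ℂ ψ χ = 0 := fun ψ hψ χ hχ =>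
    mem_compl.mp (hTS χ hχ) ψ hψ
  have hU := hS'.union hT hST
  have hUcard := card_union_of_orthogonal hS' hST
  have h0 : compl (S.image (embed e) ∪ T) = ⊥ := by
    have h1 := hU.card_add_finrank_compl
    have h2 := hS'.card_add_finrank_compl
    exact Submodule.finrank_eq_zero.mp (by omega)
  have hproj : complProj (S.image (embed e) ∪ T) = 0 := by
    apply Matrix.ext_of_mulVec_single
    intro y
    have h1 := complProj_mulVec (S.image (embed e) ∪ T) (WithLp.toLp 2 (Pi.single y 1))
    have h2 := hU.complProj_mulVec_mem (WithLp.toLp 2 (Pi.single y 1))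
    rw [h0, Submodule.mem_bot] at h2
    rw [h2] at h1
    rw [Matrix.zero_mulVec]
    exact h1
  choose φ hφ hφT using fun χ : T => hT.1 χ χ.2
  -- The completed basis resolves the identity of the large space. Compressed to the original
  -- coordinates, embedded members return to `S`, and each member of `T` becomes a product vector,
  -- possibly shortened or zero.
  have hS1 : complProj S = ∑ χ : T, proj (tensor fun i =>
      (WithLp.toLp 2 fun a => φ χ i (Fin.castLE (he i) a) : EuclideanSpace ℂ (Fin (d i)))) := by
    have hdisj : Disjoint (S.image (embed e)) T :=
      Finset.disjoint_left.mpr fun ψ hψ hψ' =>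
        (hS'.1 ψ hψ).ne_zero (inner_self_eq_zero.mp (hST ψ hψ ψ hψ'))
    rw [complProj, Finset.sum_union hdisj, Finset.sum_image (embed_injective he).injOn,
      sub_eq_zero] at hproj
    ext x y
    have h1 := congrFun (congrFun hproj (indexIncl he x)) (indexIncl he y)
    rw [Matrix.add_apply, Matrix.sum_apply, Matrix.sum_apply, Matrix.one_apply] at h1
    simp only [proj_apply, embed_indexIncl, (indexIncl_injective he).eq_iff] at h1
    rw [complProj, Matrix.sub_apply, Matrix.one_apply, Matrix.sum_apply, Matrix.sum_apply]
    simp only [proj_apply]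
    rw [h1, add_sub_cancel_left, ← Finset.sum_coe_sort T]
    refine Finset.sum_congr rfl fun χ _ => ?_
    rw [hφT χ]
    rfl
  refine hsep ?_
  rw [complState_eq, hS1, normalization_eq, ← Complex.ofReal_inv]
  exact isSeparable_of_eq_sum_tensor hd (normalization_inv_nonneg hS) _

end LocalExtension

/-! ### Bipartite product vectors -/

section Bipartite

variable {a b : ℕ}

/-- The pair `(v, w)` as a family of local vectors. -/
def pairVec (v : EuclideanSpace ℂ (Fin a)) (w : EuclideanSpace ℂ (Fin b)) :
    ∀ i : Fin 2, EuclideanSpace ℂ (Fin (![a, b] i)) :=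
  Fin.cons (α := fun i => EuclideanSpace ℂ (Fin (![a, b] i))) v
    (Fin.cons (α := fun i : Fin 1 => EuclideanSpace ℂ (Fin (![a, b] i.succ))) w finZeroElim)

theorem tmul_eq_tensor (v : EuclideanSpace ℂ (Fin a)) (w : EuclideanSpace ℂ (Fin b)) :
    tmul v w = tensor (pairVec v w) := by
  ext x
  rw [tensor_apply, Fin.prod_univ_two]
  rfl

theorem tensor_eq_tmul (φ : ∀ i : Fin 2, EuclideanSpace ℂ (Fin (![a, b] i))) :
    tensor φ = tmul (φ 0) (φ 1) := by
  ext x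
  rw [tensor_apply, Fin.prod_univ_two]
  rfl

theorem inner_tmul (v v' : EuclideanSpace ℂ (Fin a)) (w w' : EuclideanSpace ℂ (Fin b)) :
    inner ℂ (tmul v w) (tmul v' w') = inner ℂ v v' * inner ℂ w w' := by
  rw [tmul_eq_tensor, tmul_eq_tensor, inner_tensor, Fin.prod_univ_two]
  rfl

theorem norm_tmul (v : EuclideanSpace ℂ (Fin a)) (w : EuclideanSpace ℂ (Fin b)) :
    ‖tmul v w‖ = ‖v‖ * ‖w‖ := by
  rw [tmul_eq_tensor, norm_tensor, Fin.prod_univ_two]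
  rfl

theorem tmul_smul_smul (c c' : ℂ) (v : EuclideanSpace ℂ (Fin a))
    (w : EuclideanSpace ℂ (Fin b)) : tmul (c • v) (c' • w) = (c * c') • tmul v w := by
  ext x
  exact mul_mul_mul_comm c _ c' _

theorem isProductState_smul_tmul (c : ℂ) (v : EuclideanSpace ℂ (Fin a))
    (w : EuclideanSpace ℂ (Fin b)) (h : ‖c • tmul v w‖ = 1) :
    IsProductState (c • tmul v w) := by
  rw [tmul_eq_tensor] at h ⊢
  exact isProductState_smul_tensor 0 c _ h

theorem isProductState_tmul (v : EuclideanSpace ℂ (Fin a))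
    (w : EuclideanSpace ℂ (Fin b)) (h : ‖tmul v w‖ = 1) : IsProductState (tmul v w) := by
  have := isProductState_smul_tmul 1 v w
  rw [one_smul] at this
  exact this h

theorem IsProductState.exists_tmul {ψ : Space ![a, b]} (h : IsProductState ψ) :
    ∃ (v : EuclideanSpace ℂ (Fin a)) (w : EuclideanSpace ℂ (Fin b)), ψ = tmul v w := by
  obtain ⟨φ, -, rfl⟩ := h
  exact ⟨_, _, tensor_eq_tmul φ⟩

end Bipartite

theorem eq_zero_of_forall_inner_eq_zero {n : ℕ} {f : Fin n → EuclideanSpace ℂ (Fin n)}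
    (hf : LinearIndependent ℂ f) {x : EuclideanSpace ℂ (Fin n)}
    (hx : ∀ i, inner ℂ (f i) x = 0) : x = 0 := by
  have htop : Submodule.span ℂ (Set.range f) = ⊤ :=
    hf.span_eq_top_of_card_eq_finrank' (by simp)
  have hmem : x ∈ (Submodule.span ℂ (Set.range f))ᗮ := by
    rw [Submodule.mem_orthogonal]
    intro u hu
    induction hu using Submodule.span_induction with
    | mem y hy => obtain ⟨i, rfl⟩ := hy; exact hx i
    | zero => simp
    | add y z _ _ hy hz => rw [inner_add_left, hy, hz, add_zero]
    | smul a y _ hy => rw [inner_smul_left, hy, mul_zero]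
  simpa [htop] using hmem

/-! ### Pentagonal families -/

section Pentagon

theorem fin_five_cases : ∀ d : Fin 5, d = 0 ∨ d = 1 ∨ d = 2 ∨ d = 3 ∨ d = 4 := by decide

/-- The inner products of the vectors of the pentagonal pyramid, by index difference. -/
def gramV (g : ℂ) : Fin 5 → ℂ := ![1, g, 0, 0, g]

/-- The inner products of the four-dimensional pentagonal vectors, by index difference. -/
def gramW : Fin 5 → ℂ := ![1, 0, -1 / 2, -1 / 2, 0]

/-- Families with the inner products of the vectors of **Pyr34**; `g` is the inverse golden
ratio. -/
structure IsPentagonal (g : ℂ) (v : Fin 5 → EuclideanSpace ℂ (Fin 3))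
    (w : Fin 5 → EuclideanSpace ℂ (Fin 4)) : Prop where
  conj_g : star g = g
  g_sq : g ^ 2 = 1 - g
  inner_v : ∀ i j, inner ℂ (v i) (v j) = gramV g (j - i)
  inner_w : ∀ i j, inner ℂ (w i) (w j) = gramW (j - i)

/-- The first factors of the product vectors orthogonal to all `v j ⊗ w j`. -/
def leftVec (g : ℂ) (v : Fin 5 → EuclideanSpace ℂ (Fin 3)) :
    Fin 5 × Bool → EuclideanSpace ℂ (Fin 3)
  | (k, false) => v k
  | (k, true) => v k - g • (v (k + 1) + v (k + 4))

/-- The second factors of the product vectors orthogonal to all `v j ⊗ w j`. -/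
def rightVec (w : Fin 5 → EuclideanSpace ℂ (Fin 4)) :
    Fin 5 × Bool → EuclideanSpace ℂ (Fin 4)
  | (k, false) => w (k + 4) - w (k + 1) + (3 : ℂ) • (w (k + 2) - w (k + 3))
  | (k, true) => (2 : ℂ) • (w (k + 1) - w (k + 4)) - (w (k + 2) - w (k + 3))

/-- The overlaps of `leftVec` with the vectors `v j`. -/
def leftOverlap (g : ℂ) : Bool → Fin 5 → ℂ
  | false => ![1, g, 0, 0, g]
  | true => ![1 - 2 * g ^ 2, 0, -g ^ 2, -g ^ 2, 0]

/-- The overlaps of `rightVec` with the vectors `w j`. -/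
def rightOverlap : Bool → Fin 5 → ℂ
  | false => ![0, 0, 5 / 2, -5 / 2, 0]
  | true => ![0, 5 / 2, 0, 0, -5 / 2]

namespace IsPentagonal

variable {g : ℂ} {v : Fin 5 → EuclideanSpace ℂ (Fin 3)} {w : Fin 5 → EuclideanSpace ℂ (Fin 4)}

theorem g_ne_zero (h : IsPentagonal g v w) : g ≠ 0 := by
  rintro rfl
  simpa using h.g_sq

theorem one_sub_ne_zero (h : IsPentagonal g v w) : 1 - 2 * g ^ 2 ≠ 0 := by
  intro h0
  -- A Bézout identity for the coprime polynomials `1 - 2 * g ^ 2` and `g ^ 2 + g - 1`.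
  have h1 : (1 : ℂ) = 0 := by linear_combination (2 * g + 3) * h0 + (4 * g + 2) * h.g_sq
  exact one_ne_zero h1

theorem inner_v_add (h : IsPentagonal g v w) (k i j : Fin 5) :
    inner ℂ (v (k + i)) (v (k + j)) = gramV g (j - i) := by
  rw [h.inner_v, add_sub_add_left_eq_sub]

theorem inner_w_add (h : IsPentagonal g v w) (k i j : Fin 5) :
    inner ℂ (w (k + i)) (w (k + j)) = gramW (j - i) := by
  rw [h.inner_w, add_sub_add_left_eq_sub]

theorem inner_leftVec (h : IsPentagonal g v w) (k d : Fin 5) (s : Bool) :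
    inner ℂ (v (k + d)) (leftVec g v (k, s)) = leftOverlap g s d := by
  have h0 : ∀ i, inner ℂ (v (k + i)) (v k) = gramV g (0 - i) := fun i => by
    simpa using h.inner_v_add k i 0
  cases s
  · simp only [leftVec, h0]
    fin_cases d <;> simp [gramV, leftOverlap]
  · simp only [leftVec, inner_sub_right, inner_smul_right, inner_add_right, h0, h.inner_v_add]
    fin_cases d <;> simp [gramV, leftOverlap] <;> ring

theorem inner_rightVec (h : IsPentagonal g v w) (k d : Fin 5) (s : Bool) :
    inner ℂ (w (k + d)) (rightVec w (k, s)) = rightOverlap s d := by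
  cases s <;>
  · simp only [rightVec, inner_sub_right, inner_smul_right, inner_add_right, h.inner_w_add]
    fin_cases d <;> simp [gramW, rightOverlap] <;> ring

theorem inner_leftVec' (h : IsPentagonal g v w) (k j : Fin 5) (s : Bool) :
    inner ℂ (v j) (leftVec g v (k, s)) = leftOverlap g s (j - k) := by
  rw [← h.inner_leftVec k, add_sub_cancel]

theorem inner_rightVec' (h : IsPentagonal g v w) (k j : Fin 5) (s : Bool) :
    inner ℂ (w j) (rightVec w (k, s)) = rightOverlap s (j - k) := by
  rw [← h.inner_rightVec k, add_sub_cancel]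

/-- In a regular pentagon a diagonal is parallel to the opposite side and longer by the golden ratio
`1 + g`. The squared norm of the difference is computed from the inner products. -/
theorem v_add_three (h : IsPentagonal g v w) (k : Fin 5) :
    v (k + 3) - v k - (1 + g) • (v (k + 2) - v (k + 1)) = 0 := by
  have h0 : ∀ i, inner ℂ (v (k + i)) (v k) = gramV g (0 - i) := fun i => by
    simpa using h.inner_v_add k i 0
  have h0' : ∀ i, inner ℂ (v k) (v (k + i)) = gramV g i := fun i => by
    simpa using h.inner_v_add k 0 i
  rw [← inner_self_eq_zero (𝕜 := ℂ)]
  simp only [inner_sub_left, inner_sub_right, inner_smul_left,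
    inner_smul_right, h.inner_v_add, h0, h0', h.inner_v, map_add, map_one]
  rw [show (starRingEnd ℂ) g = g from h.conj_g]
  simp [gramV]
  linear_combination (-2 * g - 4) * h.g_sq

/-- The Gram matrix of three consecutive vectors has determinant `1 - 2 * g ^ 2`, which is nonzero.
-/
theorem eq_zero_of_consecutive (h : IsPentagonal g v w) (k : Fin 5) {x : EuclideanSpace ℂ (Fin 3)}
    (h0 : inner ℂ (v k) x = 0) (h1 : inner ℂ (v (k + 1)) x = 0)
    (h2 : inner ℂ (v (k + 2)) x = 0) : x = 0 := by
  have hli : LinearIndependent ℂ ![v k, v (k + 1), v (k + 2)] := by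
    rw [Fintype.linearIndependent_iff]
    intro c hc
    rw [Fin.sum_univ_three] at hc
    change c 0 • v k + c 1 • v (k + 1) + c 2 • v (k + 2) = 0 at hc
    have e : ∀ i, c 0 * gramV g (0 - i) + c 1 * gramV g (1 - i) + c 2 * gramV g (2 - i) = 0 := by
      intro i
      have := congrArg (fun y => inner ℂ (v (k + i)) y) hc
      have h0 : inner ℂ (v (k + i)) (v k) = gramV g (0 - i) := by
        simpa using h.inner_v_add k i 0
      simpa only [inner_add_right, inner_smul_right, h0, h.inner_v_add, inner_zero_right] using this
    have e0 := e 0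
    have e1 := e 1
    have e2 := e 2
    simp [gramV] at e0 e1 e2
    have hc1 : c 1 = 0 := by
      refine (mul_eq_zero.mp (?_ : c 1 * (1 - 2 * g ^ 2) = 0)).resolve_right h.one_sub_ne_zero
      linear_combination e1 - g * e0 - g * e2
    have hc0 : c 0 = 0 := by linear_combination e0 - g * hc1
    have hc2 : c 2 = 0 := by linear_combination e2 - g * hc1
    intro i
    fin_cases i
    exacts [hc0, hc1, hc2]
  refine eq_zero_of_forall_inner_eq_zero hli fun i => ?_
  fin_cases i
  exacts [h0, h1, h2]

/-- Since `1 + g ≠ 0`, the parallelism `v_add_three` supplies orthogonality to the skipped vector `v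
(k + 2)`. -/
theorem eq_zero_of_skip (h : IsPentagonal g v w) (k : Fin 5) {x : EuclideanSpace ℂ (Fin 3)}
    (h0 : inner ℂ (v k) x = 0) (h1 : inner ℂ (v (k + 1)) x = 0)
    (h3 : inner ℂ (v (k + 3)) x = 0) : x = 0 := by
  refine h.eq_zero_of_consecutive k h0 h1 ?_
  have h2 := congrArg (fun y => inner ℂ y x) (h.v_add_three k)
  simp only [inner_sub_left, inner_smul_left, h0, h1, h3, inner_zero_left, sub_zero, zero_sub,
    neg_eq_zero, mul_eq_zero, map_add, map_one] at h2
  refine h2.resolve_left ?_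
  rw [show (starRingEnd ℂ) g = g from h.conj_g]
  intro hg
  have := h.g_sq
  have h4 : (1 : ℂ) = 0 := by linear_combination g * hg - this
  exact one_ne_zero h4

theorem eq_zero_of_four (h : IsPentagonal g v w) (k : Fin 5) {y : EuclideanSpace ℂ (Fin 4)}
    (h0 : inner ℂ (w k) y = 0) (h1 : inner ℂ (w (k + 1)) y = 0)
    (h2 : inner ℂ (w (k + 2)) y = 0) (h3 : inner ℂ (w (k + 3)) y = 0) : y = 0 := by
  have hli : LinearIndependent ℂ ![w k, w (k + 1), w (k + 2), w (k + 3)] := by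
    rw [Fintype.linearIndependent_iff]
    intro c hc
    rw [Fin.sum_univ_four] at hc
    change c 0 • w k + c 1 • w (k + 1) + c 2 • w (k + 2) + c 3 • w (k + 3) = 0 at hc
    have e : ∀ i, c 0 * gramW (0 - i) + c 1 * gramW (1 - i) + c 2 * gramW (2 - i) +
        c 3 * gramW (3 - i) = 0 := by
      intro i
      have := congrArg (fun y => inner ℂ (w (k + i)) y) hc
      have h0 : inner ℂ (w (k + i)) (w k) = gramW (0 - i) := by
        simpa using h.inner_w_add k i 0
      simpa only [inner_add_right, inner_smul_right, h0, h.inner_w_add, inner_zero_right] using this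
    have e0 := e 0
    have e1 := e 1
    have e2 := e 2
    have e3 := e 3
    simp [gramW] at e0 e1 e2 e3
    -- The coefficients form the third row of the inverse of the Gram matrix.
    have hc2 : c 2 = 0 := by
      linear_combination (6 / 5) * e0 + (2 / 5) * e1 + (8 / 5) * e2 + (4 / 5) * e3
    have hc0 : c 0 = 0 := by linear_combination 2 * hc2 - 2 * e2
    have hc3 : c 3 = 0 := by linear_combination 2 * hc0 - hc2 - 2 * e0
    have hc1 : c 1 = 0 := by linear_combination e1 + hc3 / 2
    intro i
    fin_cases i
    exacts [hc0, hc1, hc2, hc3]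
  refine eq_zero_of_forall_inner_eq_zero hli fun i => ?_
  fin_cases i
  exacts [h0, h1, h2, h3]

/-- A vector orthogonal to `v (k + 2)` and `v (k + 3)`, respectively to `v (k + 1)` and
`v (k + 4)`, is a multiple of `leftVec`. -/
theorem exists_eq_smul_leftVec (h : IsPentagonal g v w) (k : Fin 5) (s : Bool)
    {x : EuclideanSpace ℂ (Fin 3)}
    (hx : ∀ d, leftOverlap g s d = 0 → inner ℂ (v (k + d)) x = 0) :
    ∃ c : ℂ, x = c • leftVec g v (k, s) := by
  cases s
  -- One nonzero overlap fixes the scalar, here the overlap `1` with `v k`. The difference is then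
  -- orthogonal to three spanning vectors.
  · refine ⟨inner ℂ (v k) x, sub_eq_zero.mp (h.eq_zero_of_skip (k + 2) ?_ ?_ ?_)⟩
    · rw [inner_sub_right, inner_smul_right, h.inner_leftVec, hx 2 rfl]; simp [leftOverlap]
    · rw [add_assoc, inner_sub_right, inner_smul_right, h.inner_leftVec, hx _ rfl]
      simp [leftOverlap]
    · rw [add_assoc, show (2 + 3 : Fin 5) = 0 from rfl, inner_sub_right, inner_smul_right,
        h.inner_leftVec, add_zero]
      simp [leftOverlap]
  · have hg := pow_ne_zero 2 h.g_ne_zero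
    refine ⟨inner ℂ (v (k + 2)) x / (-g ^ 2),
      sub_eq_zero.mp (h.eq_zero_of_skip (k + 1) ?_ ?_ ?_)⟩
    · rw [inner_sub_right, inner_smul_right, h.inner_leftVec, hx 1 rfl]; simp [leftOverlap]
    · rw [add_assoc, show (1 + 1 : Fin 5) = 2 from rfl, inner_sub_right, inner_smul_right,
        h.inner_leftVec]
      simp [leftOverlap, div_neg, hg]
    · rw [add_assoc, show (1 + 3 : Fin 5) = 4 from rfl, inner_sub_right, inner_smul_right,
        h.inner_leftVec, hx 4 rfl]
      simp [leftOverlap]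

theorem exists_eq_smul_rightVec (h : IsPentagonal g v w) (k : Fin 5) (s : Bool)
    {y : EuclideanSpace ℂ (Fin 4)}
    (hy : ∀ d, rightOverlap s d = 0 → inner ℂ (w (k + d)) y = 0) :
    ∃ c : ℂ, y = c • rightVec w (k, s) := by
  have h3 : ∀ a b : Fin 5, (k + a) + b = k + (a + b) := fun a b => add_assoc _ _ _
  cases s
  -- The factor `2 / 5` inverts the overlap `5 / 2` of `rightVec` with `w (k + 2)`.
  · refine ⟨2 / 5 * inner ℂ (w (k + 2)) y, sub_eq_zero.mp (h.eq_zero_of_four (k + 4) ?_ ?_ ?_ ?_)⟩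
    · rw [inner_sub_right, inner_smul_right, h.inner_rightVec, hy 4 rfl]; simp [rightOverlap]
    · rw [h3, show (4 + 1 : Fin 5) = 0 from rfl, inner_sub_right, inner_smul_right,
        h.inner_rightVec, hy 0 rfl]
      simp [rightOverlap]
    · rw [h3, show (4 + 2 : Fin 5) = 1 from rfl, inner_sub_right, inner_smul_right,
        h.inner_rightVec, hy 1 rfl]
      simp [rightOverlap]
    · rw [h3, show (4 + 3 : Fin 5) = 2 from rfl, inner_sub_right, inner_smul_right,
        h.inner_rightVec]
      simp [rightOverlap]
      ring
  · refine ⟨2 / 5 * inner ℂ (w (k + 1)) y, sub_eq_zero.mp (h.eq_zero_of_four (k + 0) ?_ ?_ ?_ ?_)⟩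
    · rw [inner_sub_right, inner_smul_right, h.inner_rightVec, hy 0 rfl]; simp [rightOverlap]
    · rw [h3, zero_add, inner_sub_right, inner_smul_right, h.inner_rightVec]
      simp [rightOverlap]
      ring
    · rw [h3, zero_add, inner_sub_right, inner_smul_right, h.inner_rightVec, hy 2 rfl]
      simp [rightOverlap]
    · rw [h3, zero_add, inner_sub_right, inner_smul_right, h.inner_rightVec, hy 3 rfl]
      simp [rightOverlap]

/-- Ten product vectors, indexed by `Fin 5 × Bool`. -/
def line (g : ℂ) (v : Fin 5 → EuclideanSpace ℂ (Fin 3)) (w : Fin 5 → EuclideanSpace ℂ (Fin 4))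
    (i : Fin 5 × Bool) : Space ![3, 4] :=
  tmul (leftVec g v i) (rightVec w i)

end IsPentagonal

/-- The pairs `{2, 3}` and `{1, 4}` of the pentagon. -/
def pentagonChord : Bool → Fin 5 → Bool
  | false => ![false, false, true, true, false]
  | true => ![false, true, false, false, true]

theorem rightOverlap_eq_zero_iff (s : Bool) (d : Fin 5) :
    rightOverlap s d = 0 ↔ pentagonChord s d = false := by
  obtain rfl | rfl | rfl | rfl | rfl := fin_five_cases d
  all_goals cases s <;> simp [rightOverlap, pentagonChord]

/-- Distinguishes the ten lines: `v x ⊗ w y` has nonzero overlap with line `i'`, while its second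
factor is orthogonal to that of line `i`. -/
theorem exists_separating_pair : ∀ i i' : Fin 5 × Bool, i ≠ i' →
    ∃ x y : Fin 5, pentagonChord i'.2 (x - i'.1) = false ∧
      pentagonChord i'.2 (y - i'.1) = true ∧ pentagonChord i.2 (y - i.1) = false := by
  decide

/-- A subset of the pentagon with no three elements whose complement has no four elements is a
side or a diagonal. -/
theorem exists_side_or_diagonal : ∀ z : Fin 5 → Bool,
    (∀ k, ¬ (z k = true ∧ z (k + 1) = true ∧ z (k + 2) = true)) →
    (∀ k, ¬ (z k = true ∧ z (k + 1) = true ∧ z (k + 3) = true)) →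
    (∀ k, ¬ (z k = false ∧ z (k + 1) = false ∧ z (k + 2) = false ∧ z (k + 3) = false)) →
    ∃ (k : Fin 5), (z (k + 2) = true ∧ z (k + 3) = true ∧ z k = false ∧ z (k + 1) = false ∧
        z (k + 4) = false) ∨
      (z (k + 1) = true ∧ z (k + 4) = true ∧ z k = false ∧ z (k + 2) = false ∧
        z (k + 3) = false) := by
  decide

namespace IsPentagonal

variable {g : ℂ} {v : Fin 5 → EuclideanSpace ℂ (Fin 3)} {w : Fin 5 → EuclideanSpace ℂ (Fin 4)}

/-- The product vectors orthogonal to all `v j ⊗ w j` lie on ten lines. -/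
theorem exists_eq_smul_line (h : IsPentagonal g v w) {ψ : Space ![3, 4]} (hψ : IsProductState ψ)
    (horth : ∀ j, inner ℂ (tmul (v j) (w j)) ψ = 0) :
    ∃ (i : Fin 5 × Bool) (c : ℂ), ψ = c • line g v w i := by
  have hne := hψ.ne_zero
  obtain ⟨x, y, rfl⟩ := hψ.exists_tmul
  have hx : x ≠ 0 := by
    rintro rfl
    exact hne (by ext p; exact zero_mul _)
  have hy : y ≠ 0 := by
    rintro rfl
    exact hne (by ext p; exact mul_zero _)
  classical
  -- `z` marks the `j` with `x ⟂ v j`; at every other `j` orthogonality must come from `y ⟂ w j`.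
  set z : Fin 5 → Bool := fun j => decide (inner ℂ (v j) x = 0) with hz
  have hzt : ∀ j, z j = true → inner ℂ (v j) x = 0 := fun j hj => of_decide_eq_true hj
  have hzf : ∀ j, z j = false → inner ℂ (w j) y = 0 := fun j hj => by
    have h1 := horth j
    rw [inner_tmul] at h1
    exact (mul_eq_zero.mp h1).resolve_left (of_decide_eq_false hj)
  have hg := h.g_ne_zero
  have hg' := h.one_sub_ne_zero
  have hkey : ∀ k s, (∀ d, leftOverlap g s d = 0 → inner ℂ (v (k + d)) x = 0) →
      (∀ d, rightOverlap s d = 0 → inner ℂ (w (k + d)) y = 0) →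
      ∃ (i : Fin 5 × Bool) (c : ℂ), tmul x y = c • line g v w i := by
    intro k s h1 h2
    obtain ⟨c, hc⟩ := h.exists_eq_smul_leftVec k s h1
    obtain ⟨c', hc'⟩ := h.exists_eq_smul_rightVec k s h2
    exact ⟨(k, s), c * c', by rw [hc, hc', tmul_smul_smul, line]⟩
  obtain ⟨k, hk | hk⟩ := exists_side_or_diagonal z
    (fun k hk => hx (h.eq_zero_of_consecutive k (hzt _ hk.1) (hzt _ hk.2.1) (hzt _ hk.2.2)))
    (fun k hk => hx (h.eq_zero_of_skip k (hzt _ hk.1) (hzt _ hk.2.1) (hzt _ hk.2.2)))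
    (fun k hk => hy (h.eq_zero_of_four k (hzf _ hk.1) (hzf _ hk.2.1) (hzf _ hk.2.2.1)
      (hzf _ hk.2.2.2)))
  · obtain ⟨z2, z3, z0, z1, z4⟩ := hk
    refine hkey k false (fun d hd => ?_) (fun d hd => ?_)
    · fin_cases d
      · simp [leftOverlap] at hd
      · exact absurd hd hg
      · exact hzt _ z2
      · exact hzt _ z3
      · exact absurd hd hg
    · fin_cases d
      · exact hzf _ (by simpa using z0)
      · exact hzf _ z1
      · norm_num [rightOverlap] at hd
      · norm_num [rightOverlap] at hd
      · exact hzf _ z4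
  · obtain ⟨z1, z4, z0, z2, z3⟩ := hk
    refine hkey k true (fun d hd => ?_) (fun d hd => ?_)
    · fin_cases d
      · exact absurd hd hg'
      · exact hzt _ z1
      · exact absurd hd (neg_ne_zero.mpr (pow_ne_zero 2 hg))
      · exact absurd hd (neg_ne_zero.mpr (pow_ne_zero 2 hg))
      · exact hzt _ z4
    · fin_cases d
      · exact hzf _ (by simpa using z0)
      · norm_num [rightOverlap] at hd
      · exact hzf _ z2
      · exact hzf _ z3
      · norm_num [rightOverlap] at hd

theorem inner_line (h : IsPentagonal g v w) (j : Fin 5) (i : Fin 5 × Bool) :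
    inner ℂ (tmul (v j) (w j)) (line g v w i) = 0 := by
  obtain ⟨k, s⟩ := i
  rw [line, inner_tmul, h.inner_leftVec', h.inner_rightVec']
  generalize j - k = d
  cases s <;> fin_cases d <;> simp [leftOverlap, rightOverlap]

/-- The four lines orthogonal to `line (k, false)`. -/
def neighbours (k : Fin 5) : Finset (Fin 5 × Bool) :=
  {(k + 2, false), (k + 3, false), (k + 1, true), (k + 4, true)}

/-- The first factor of `line (k, false)` is `v k`, and it alone decides: whenever the first factors
are not orthogonal, the overlap of the second factors is nonzero too. -/
theorem inner_line_false (h : IsPentagonal g v w) (k : Fin 5) (i : Fin 5 × Bool) :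
    inner ℂ (line g v w (k, false)) (line g v w i) = 0 ↔ i ∈ neighbours k := by
  have hg := h.g_ne_zero
  have hg' := h.one_sub_ne_zero
  obtain ⟨l, s⟩ := i
  obtain ⟨d, rfl⟩ : ∃ d, k = l + d := ⟨k - l, by rw [add_sub_cancel]⟩
  have h1 : inner ℂ (line g v w (l + d, false)) (line g v w (l, s)) = leftOverlap g s d *
      (rightOverlap s (d + 4) - rightOverlap s (d + 1) +
        3 * (rightOverlap s (d + 2) - rightOverlap s (d + 3))) := by
    rw [line, line, inner_tmul]
    change inner ℂ (v (l + d)) _ * inner ℂ (w (l + d + 4) - w (l + d + 1) +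
      (3 : ℂ) • (w (l + d + 2) - w (l + d + 3))) _ = _
    rw [h.inner_leftVec, inner_add_left, inner_smul_left, inner_sub_left, inner_sub_left]
    simp only [add_assoc, h.inner_rightVec, map_ofNat]
  have h2 : ∀ (l d : Fin 5) (s : Bool), (l, s) ∈ neighbours (l + d) ↔
      (s = false ∧ (d = 2 ∨ d = 3)) ∨ (s = true ∧ (d = 1 ∨ d = 4)) := by
    decide
  rw [h1, h2]
  obtain rfl | rfl | rfl | rfl | rfl : d = 0 ∨ d = 1 ∨ d = 2 ∨ d = 3 ∨ d = 4 := fin_five_cases d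
  all_goals cases s <;> simp [leftOverlap, rightOverlap, hg, hg'] <;> norm_num

theorem line_ne_zero (h : IsPentagonal g v w) (i : Fin 5 × Bool) : line g v w i ≠ 0 := by
  obtain ⟨k, s⟩ := i
  intro h0
  have hg := h.g_ne_zero
  have hg' := h.one_sub_ne_zero
  cases s
  · have h1 := inner_tmul (v (k + 0)) (leftVec g v (k, false)) (w (k + 2)) (rightVec w (k, false))
    rw [line] at h0
    rw [h0, h.inner_leftVec, h.inner_rightVec, inner_zero_right] at h1
    simp [leftOverlap, rightOverlap] at h1
    norm_num at h1
  · have h1 := inner_tmul (v (k + 0)) (leftVec g v (k, true)) (w (k + 1)) (rightVec w (k, true))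
    rw [line] at h0
    rw [h0, h.inner_leftVec, h.inner_rightVec, inner_zero_right] at h1
    simp [leftOverlap, rightOverlap] at h1
    exact hg' h1

theorem leftOverlap_eq_zero_iff (h : IsPentagonal g v w) (s : Bool) (d : Fin 5) :
    leftOverlap g s d = 0 ↔ pentagonChord s d = true := by
  have hg := h.g_ne_zero
  have hg' := h.one_sub_ne_zero
  obtain rfl | rfl | rfl | rfl | rfl := fin_five_cases d
  all_goals cases s <;> simp [leftOverlap, pentagonChord, hg, hg']

/-- The ten lines are different. -/
theorem span_line_injective (h : IsPentagonal g v w) :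
    Function.Injective fun i => Submodule.span ℂ {line g v w i} := by
  intro i i' hii
  by_contra hne
  obtain ⟨x, y, hx, hy, hy'⟩ := exists_separating_pair i i' hne
  have hmem : line g v w i' ∈ Submodule.span ℂ {line g v w i} := by
    have : Submodule.span ℂ {line g v w i} = Submodule.span ℂ {line g v w i'} := hii
    rw [this]
    exact Submodule.mem_span_singleton_self _
  obtain ⟨c, hc⟩ := Submodule.mem_span_singleton.mp hmem
  have h1 := inner_tmul (v x) (leftVec g v i') (w y) (rightVec w i')
  change inner ℂ (tmul (v x) (w y)) (line g v w i') = _ at h1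
  rw [← hc, inner_smul_right, line, inner_tmul, h.inner_rightVec' i.1 y i.2, (rightOverlap_eq_zero_iff
    i.2 (y - i.1)).mpr hy', mul_zero, mul_zero] at h1
  rcases mul_eq_zero.mp h1.symm with h2 | h2
  · rw [h.inner_leftVec' i'.1 x i'.2, h.leftOverlap_eq_zero_iff, hx] at h2
    exact Bool.noConfusion h2
  · rw [h.inner_rightVec' i'.1 y i'.2, rightOverlap_eq_zero_iff, hy] at h2
    exact Bool.noConfusion h2

end IsPentagonal

end Pentagon

/-! ### The inner products of the vectors of Pyr34 -/

section Pyr34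

theorem cos_two_pi_div_five : Real.cos (2 * Real.pi / 5) = (√5 - 1) / 4 := by
  have h5 : √5 ^ 2 = 5 := Real.sq_sqrt (by norm_num)
  rw [show 2 * Real.pi / 5 = 2 * (Real.pi / 5) by ring, Real.cos_two_mul, Real.cos_pi_div_five]
  linear_combination h5 / 8

theorem cos_four_pi_div_five : Real.cos (4 * Real.pi / 5) = -(1 + √5) / 4 := by
  rw [show 4 * Real.pi / 5 = Real.pi - Real.pi / 5 by ring, Real.cos_pi_sub,
    Real.cos_pi_div_five]
  ring

/-- The real parts of the fifth roots of unity. -/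
def cosFive : Fin 5 → ℝ :=
  ![1, (√5 - 1) / 4, -(1 + √5) / 4, -(1 + √5) / 4, (√5 - 1) / 4]

theorem cos_two_pi_mul_div_five (d : Fin 5) :
    Real.cos (2 * Real.pi * (d : ℕ) / 5) = cosFive d := by
  obtain rfl | rfl | rfl | rfl | rfl := fin_five_cases d
  · simp [cosFive]
  · simpa [cosFive] using cos_two_pi_div_five
  · rw [show 2 * Real.pi * ((2 : Fin 5) : ℕ) / 5 = 4 * Real.pi / 5 by norm_num; ring,
      cos_four_pi_div_five]
    simp [cosFive]
  · rw [show 2 * Real.pi * ((3 : Fin 5) : ℕ) / 5 = 2 * Real.pi - 4 * Real.pi / 5 by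
      norm_num; ring, Real.cos_two_pi_sub, cos_four_pi_div_five]
    simp [cosFive]
  · rw [show 2 * Real.pi * ((4 : Fin 5) : ℕ) / 5 = 2 * Real.pi - 2 * Real.pi / 5 by
      norm_num; ring, Real.cos_two_pi_sub, cos_two_pi_div_five]
    simp [cosFive]

theorem cos_two_pi_int_div_five (z : ℤ) (d : Fin 5) (h : (z - (d : ℕ)) % 5 = 0) :
    Real.cos (2 * Real.pi * z / 5) = cosFive d := by
  obtain ⟨n, hn⟩ := Int.dvd_of_emod_eq_zero h
  have hz : (z : ℝ) = (d : ℕ) + 5 * n := by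
    have : z = (d : ℕ) + 5 * n := by omega
    rw [this]
    push_cast
    ring
  rw [← cos_two_pi_mul_div_five, ← Real.cos_add_int_mul_two_pi (2 * Real.pi * (d : ℕ) / 5) n, hz]
  congr 1
  ring

theorem cosFive_sub (i j : Fin 5) :
    Real.cos (2 * Real.pi * (i : ℕ) / 5) * Real.cos (2 * Real.pi * (j : ℕ) / 5) +
      Real.sin (2 * Real.pi * (i : ℕ) / 5) * Real.sin (2 * Real.pi * (j : ℕ) / 5) =
      cosFive (j - i) := by
  have h : ∀ i j : Fin 5, (((j : ℕ) - (i : ℕ) : ℤ) - ((j - i : Fin 5) : ℕ)) % 5 = 0 := by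
    decide
  rw [← cos_two_pi_int_div_five _ _ (h i j), mul_comm, mul_comm (Real.sin _), ← Real.cos_sub]
  congr 1
  push_cast
  ring

theorem cosFive_two_mul_sub (i j : Fin 5) :
    Real.cos (4 * (i : ℕ) * Real.pi / 5) * Real.cos (4 * (j : ℕ) * Real.pi / 5) +
      Real.sin (4 * (i : ℕ) * Real.pi / 5) * Real.sin (4 * (j : ℕ) * Real.pi / 5) =
      cosFive (2 * (j - i)) := by
  have h : ∀ i j : Fin 5,
      ((2 * ((j : ℕ) - (i : ℕ)) : ℤ) - ((2 * (j - i) : Fin 5) : ℕ)) % 5 = 0 := by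
    decide
  rw [← cos_two_pi_int_div_five _ _ (h i j), mul_comm, mul_comm (Real.sin _), ← Real.cos_sub]
  congr 1
  push_cast
  ring

theorem sqrt_five_sq : √5 ^ 2 = 5 := Real.sq_sqrt (by norm_num)

/-- The height of the pyramid is chosen so that its square, `(1 + √5) / 4`, cancels `cos (4π / 5)`.
This makes vectors two steps apart orthogonal. -/
theorem inner_pyrV (i j : Fin 5) :
    inner ℂ (pyrV i) (pyrV j) = gramV (((√5 - 1) / 2 : ℝ) : ℂ) (j - i) := by
  have h5 := sqrt_five_sq
  have h5' : 0 < √5 := by positivity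
  have h1 : inner ℂ (pyrV i) (pyrV j) =
      (((2 / √(5 + √5)) ^ 2 * (cosFive (j - i) + (1 / 2 * √(1 + √5)) ^ 2) : ℝ) : ℂ) := by
    rw [← cosFive_sub]
    simp only [pyrV, PiLp.inner_apply, Fin.sum_univ_three]
    simp [-Complex.ofReal_cos, -Complex.ofReal_sin, Complex.conj_ofReal, Complex.conj_ofNat,
      abs_of_nonneg, Real.sqrt_nonneg]
    ring
  have h2 : (2 / √(5 + √5)) ^ 2 = 4 / (5 + √5) := by
    rw [div_pow, Real.sq_sqrt (by positivity)]; norm_num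
  have h3 : (1 / 2 * √(1 + √5)) ^ 2 = (1 + √5) / 4 := by
    rw [mul_pow, Real.sq_sqrt (by positivity)]; ring
  rw [h1, h2, h3]
  obtain h | h | h | h | h := fin_five_cases (j - i)
  all_goals
    rw [h]
    simp only [cosFive, gramV]
    simp only [Matrix.cons_val]
    norm_cast
    try field_simp
    try ring_nf
    try rw [h5]
    try ring

/-- The weights `cos (π / 5)` and `cos (2π / 5)` of the two planes make adjacent vectors orthogonal,
because `cos (4π / 5) = -cos (π / 5)`. -/
theorem inner_pyrW (i j : Fin 5) : inner ℂ (pyrW i) (pyrW j) = gramW (j - i) := by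
  have h5 := sqrt_five_sq
  have h5' : 0 < √5 := by positivity
  have h6 : ∀ d, gramW d = ((![1, 0, -1 / 2, -1 / 2, 0] d : ℝ) : ℂ) := by
    intro d
    obtain rfl | rfl | rfl | rfl | rfl := fin_five_cases d <;> simp [gramW]
  have hc1 : 0 ≤ Real.cos (Real.pi / 5) := by rw [Real.cos_pi_div_five]; positivity
  have hc2 : 0 ≤ Real.cos (2 * Real.pi / 5) := by
    rw [cos_two_pi_div_five]; nlinarith
  have h1 : inner ℂ (pyrW i) (pyrW j) =
      ((√(2 / √5) ^ 2 * (√(Real.cos (Real.pi / 5)) ^ 2 * cosFive (j - i) +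
        √(Real.cos (2 * Real.pi / 5)) ^ 2 * cosFive (2 * (j - i))) : ℝ) : ℂ) := by
    rw [← cosFive_sub, ← cosFive_two_mul_sub]
    simp only [pyrW, PiLp.inner_apply, Fin.sum_univ_four]
    simp [-Complex.ofReal_cos, -Complex.ofReal_sin, Complex.conj_ofReal]
    ring_nf
  rw [h1, Real.sq_sqrt (by positivity), Real.sq_sqrt hc1, Real.sq_sqrt hc2,
    Real.cos_pi_div_five, cos_two_pi_div_five, h6, Complex.ofReal_inj]
  obtain h | h | h | h | h := fin_five_cases (j - i)
  all_goals
    rw [h]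
    simp only [cosFive, Fin.reduceMul]
    simp only [Matrix.cons_val]
    try field_simp
    try ring_nf
    try rw [h5]
    try ring

theorem isPentagonal_pyr : IsPentagonal (((√5 - 1) / 2 : ℝ) : ℂ) pyrV pyrW where
  conj_g := Complex.conj_ofReal _
  g_sq := by
    have h5 := sqrt_five_sq
    norm_cast
    linear_combination h5 / 4
  inner_v := inner_pyrV
  inner_w := inner_pyrW

end Pyr34

/-! ### Pyr34 and its extension -/

section Pyr34Bases

/-- The ten product vectors orthogonal to **Pyr34**. -/
def pyrLine (i : Fin 5 × Bool) : Space ![3, 4] :=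
  IsPentagonal.line (((√5 - 1) / 2 : ℝ) : ℂ) pyrV pyrW i

theorem pyrLine_ne_zero (i : Fin 5 × Bool) : pyrLine i ≠ 0 := isPentagonal_pyr.line_ne_zero i

/-- The two orthogonality patterns are complementary: `gramV` vanishes at differences 2 and 3,
`gramW` at 1 and 4. -/
theorem inner_pyr_tmul (i j : Fin 5) :
    inner ℂ (tmul (pyrV i) (pyrW i)) (tmul (pyrV j) (pyrW j)) = if i = j then 1 else 0 := by
  rw [inner_tmul, inner_pyrV, inner_pyrW]
  have h : ∀ d, gramV (((√5 - 1) / 2 : ℝ) : ℂ) d * gramW d = if d = 0 then 1 else 0 := by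
    intro d
    obtain rfl | rfl | rfl | rfl | rfl := fin_five_cases d <;> simp [gramV, gramW]
  rw [h]
  simp only [sub_eq_zero, eq_comm]

theorem orthonormal_pyr : Orthonormal ℂ fun j => tmul (pyrV j) (pyrW j) :=
  orthonormal_iff_ite.mpr inner_pyr_tmul

theorem isPB_pyr34 : IsPB pyr34 := by
  constructor
  · intro ψ hψ
    obtain ⟨j, -, rfl⟩ := Finset.mem_image.mp hψ
    exact isProductState_tmul _ _ (orthonormal_pyr.1 j)
  · intro ψ hψ χ hχ hne
    obtain ⟨i, -, rfl⟩ := Finset.mem_image.mp hψ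
    obtain ⟨j, -, rfl⟩ := Finset.mem_image.mp hχ
    exact orthonormal_pyr.2 fun h => hne (by rw [h])

theorem card_pyr34 : pyr34.card = 5 := by
  rw [pyr34, Finset.card_image_of_injective _ orthonormal_pyr.linearIndependent.injective]
  simp

theorem prod_dims : ∏ i, (![3, 4] : Fin 2 → ℕ) i = 12 := by
  simp [Fin.prod_univ_two]

theorem finrank_compl_pyr34 : Module.finrank ℂ (compl pyr34) = 7 := by
  have := isPB_pyr34.card_add_finrank_compl
  rw [card_pyr34, prod_dims] at this
  omega

theorem mem_compl_pyr34 {ψ : Space ![3, 4]} :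
    ψ ∈ compl pyr34 ↔ ∀ j, inner ℂ (tmul (pyrV j) (pyrW j)) ψ = 0 := by
  rw [mem_compl]
  refine ⟨fun h j => h _ (Finset.mem_image_of_mem _ (Finset.mem_univ j)), fun h χ hχ => ?_⟩
  obtain ⟨j, -, rfl⟩ := Finset.mem_image.mp hχ
  exact h j

theorem exists_eq_smul_pyrLine {ψ : Space ![3, 4]} (hψ : IsProductState ψ)
    (h : ψ ∈ compl pyr34) : ∃ (i : Fin 5 × Bool) (c : ℂ), ψ = c • pyrLine i :=
  isPentagonal_pyr.exists_eq_smul_line hψ (mem_compl_pyr34.mp h)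

theorem card_insert_neighbours : ∀ k : Fin 5,
    (insert (k, false) (IsPentagonal.neighbours k)).card = 5 := by decide

theorem card_filter_snd :
    ((Finset.univ : Finset (Fin 5 × Bool)).filter fun i => i.2 = true).card = 5 := by decide

/-- **Pyr34** is uncompletable. -/
theorem isUCPB_pyr34 : IsUCPB pyr34 := by
  refine ⟨isPB_pyr34, fun T hT hTS => ?_⟩
  rw [finrank_compl_pyr34]
  choose f c hf using fun χ : T => exists_eq_smul_pyrLine (hT.1 χ χ.2) (hTS χ χ.2)
  have hc : ∀ χ, c χ ≠ 0 := by
    intro χ h0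
    have h1 := hf χ
    rw [h0, zero_smul] at h1
    exact (hT.1 χ χ.2).ne_zero h1
  have hinner : ∀ χ χ' : T, χ ≠ χ' → inner ℂ (pyrLine (f χ)) (pyrLine (f χ')) = 0 := by
    intro χ χ' hne
    have h1 := hT.2 χ χ.2 χ' χ'.2 fun h => hne (Subtype.ext h)
    rw [hf χ, hf χ', inner_smul_left, inner_smul_right] at h1
    exact ((mul_eq_zero.mp h1).resolve_left ((map_ne_zero _).mpr (hc χ)) |> mul_eq_zero.mp
      ).resolve_left (hc χ')
  have hinj : Function.Injective f := by
    intro χ χ' h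
    by_contra hne
    have h1 := hinner χ χ' hne
    rw [h, inner_self_eq_zero] at h1
    exact pyrLine_ne_zero _ h1
  have hcard : T.card ≤ 5 := by
    rw [← Finset.card_attach, ← Finset.card_image_of_injective _ hinj]
    -- A member on a `false` line confines the others to its four neighbours. Otherwise all members
    -- lie on the five `true` lines.
    by_cases hside : ∃ χ : T, (f χ).2 = false
    · obtain ⟨χ, hχ⟩ := hside
      refine (Finset.card_le_card fun i hi => ?_).trans (card_insert_neighbours (f χ).1).le
      obtain ⟨χ', -, rfl⟩ := Finset.mem_image.mp hi
      have hfχ : f χ = ((f χ).1, false) := Prod.ext rfl hχ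
      rw [Finset.mem_insert]
      by_cases h : χ' = χ
      · left; rw [h]; exact hfχ
      · right
        have h1 := hinner χ χ' (Ne.symm h)
        rw [hfχ] at h1
        exact (isPentagonal_pyr.inner_line_false _ _).mp h1
    · refine (Finset.card_le_card fun i hi => ?_).trans card_filter_snd.le
      obtain ⟨χ', -, rfl⟩ := Finset.mem_image.mp hi
      rw [Finset.mem_filter]
      refine ⟨Finset.mem_univ _, ?_⟩
      by_contra h
      exact hside ⟨χ', by simpa using h⟩
  omega

theorem IsPyrU.exists_eq_smul {u : EuclideanSpace ℂ (Fin 4)} (hu : IsPyrU u) :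
    ∃ c : ℂ, c ≠ 0 ∧ u = c • rightVec pyrW (0, false) := by
  obtain ⟨hn, h0, h1, h4⟩ := hu
  obtain ⟨c, hc⟩ := isPentagonal_pyr.exists_eq_smul_rightVec 0 false (y := u) (by
    intro d hd
    rw [zero_add]
    obtain rfl | rfl | rfl | rfl | rfl := fin_five_cases d
    · exact h0
    · exact h1
    · simp [rightOverlap] at hd
    · simp [rightOverlap] at hd
    · exact h4)
  refine ⟨c, ?_, hc⟩
  rintro rfl
  rw [hc, zero_smul, norm_zero] at hn
  exact zero_ne_one hn

theorem exists_isPyrU : ∃ u : EuclideanSpace ℂ (Fin 4), IsPyrU u := by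
  have hne : rightVec pyrW (0, false) ≠ 0 := by
    intro h
    have h1 := isPentagonal_pyr.inner_rightVec 0 2 false
    rw [h, inner_zero_right] at h1
    simp [rightOverlap] at h1
    norm_num at h1
  have h2 : ∀ j, rightOverlap false j = 0 → inner ℂ (pyrW j)
      (((‖rightVec pyrW (0, false)‖⁻¹ : ℝ) : ℂ) • rightVec pyrW (0, false)) = 0 := by
    intro j hj
    have h1 := isPentagonal_pyr.inner_rightVec 0 j false
    rw [zero_add] at h1
    rw [inner_smul_right, h1, hj, mul_zero]
  refine ⟨_, ?_, h2 0 rfl, h2 1 rfl, h2 4 rfl⟩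
  rw [norm_smul, Complex.norm_real, norm_inv, norm_norm,
    inv_mul_cancel₀ (norm_ne_zero_iff.mpr hne)]

/-! ### The six-element extension of Pyr34 -/

section Plus

variable {u : EuclideanSpace ℂ (Fin 4)}

theorem IsPyrU.exists_tmul_eq (hu : IsPyrU u) :
    ∃ c : ℂ, c ≠ 0 ∧ tmul (pyrV 0) u = c • pyrLine (0, false) := by
  obtain ⟨c, hc, rfl⟩ := hu.exists_eq_smul
  refine ⟨c, hc, ?_⟩
  have := tmul_smul_smul 1 c (pyrV 0) (rightVec pyrW (0, false))
  rwa [one_smul, one_mul] at this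

theorem IsPyrU.isProductState (hu : IsPyrU u) : IsProductState (tmul (pyrV 0) u) := by
  refine isProductState_tmul _ _ ?_
  have h : ‖pyrV 0‖ ^ 2 = 1 := by
    rw [← inner_self_eq_norm_sq (𝕜 := ℂ), inner_pyrV]
    simp [gramV]
  rw [norm_tmul, hu.1, mul_one]
  exact (pow_eq_one_iff_of_nonneg (norm_nonneg _) two_ne_zero).mp h

theorem IsPyrU.mem_compl_pyr34 (hu : IsPyrU u) : tmul (pyrV 0) u ∈ compl pyr34 := by
  obtain ⟨c, -, h⟩ := hu.exists_tmul_eq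
  rw [h]
  exact Submodule.smul_mem _ _ (ProductBasis.mem_compl_pyr34.mpr fun j =>
    isPentagonal_pyr.inner_line j _)

open Classical in
theorem pyr34Plus_eq_union (u : EuclideanSpace ℂ (Fin 4)) :
    pyr34Plus u = pyr34 ∪ {tmul (pyrV 0) u} := by
  rw [pyr34Plus, Finset.insert_eq, Finset.union_comm]

theorem IsPyrU.orthogonal (hu : IsPyrU u) :
    ∀ ψ ∈ pyr34, ∀ χ ∈ ({tmul (pyrV 0) u} : Finset (Space ![3, 4])), inner ℂ ψ χ = 0 := by
  intro ψ hψ χ hχ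
  rw [Finset.mem_singleton.mp hχ]
  exact mem_compl.mp hu.mem_compl_pyr34 ψ hψ

theorem IsPyrU.isPB (hu : IsPyrU u) : IsPB (pyr34Plus u) := by
  rw [pyr34Plus_eq_union]
  refine isPB_pyr34.union ⟨?_, ?_⟩ hu.orthogonal
  · simpa using hu.isProductState
  · simp +contextual

theorem IsPyrU.card_eq (hu : IsPyrU u) : (pyr34Plus u).card = 6 := by
  rw [pyr34Plus_eq_union, card_union_of_orthogonal isPB_pyr34 hu.orthogonal, card_pyr34,
    Finset.card_singleton]

theorem IsPyrU.finrank_compl (hu : IsPyrU u) :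
    Module.finrank ℂ (compl (pyr34Plus u)) = 6 := by
  have := hu.isPB.card_add_finrank_compl
  rw [hu.card_eq, prod_dims] at this
  omega

theorem IsPyrU.card_lt (hu : IsPyrU u) :
    (pyr34Plus u).card < ∏ i, (![3, 4] : Fin 2 → ℕ) i := by
  rw [hu.card_eq, prod_dims]
  norm_num

theorem IsPyrU.mem_compl_iff (hu : IsPyrU u) {ψ : Space ![3, 4]} :
    ψ ∈ compl (pyr34Plus u) ↔ ψ ∈ compl pyr34 ∧ inner ℂ (pyrLine (0, false)) ψ = 0 := by
  obtain ⟨c, hc, h⟩ := hu.exists_tmul_eq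
  rw [mem_compl, mem_compl, pyr34Plus_eq_union]
  simp only [Finset.mem_union, Finset.mem_singleton, or_imp, forall_and, forall_eq, h,
    inner_smul_left, mul_eq_zero, map_eq_zero, hc, false_or]

theorem IsPyrU.pyrLine_mem (hu : IsPyrU u) {i : Fin 5 × Bool}
    (hi : i ∈ IsPentagonal.neighbours 0) : pyrLine i ∈ compl (pyr34Plus u) :=
  hu.mem_compl_iff.mpr ⟨ProductBasis.mem_compl_pyr34.mpr fun j => isPentagonal_pyr.inner_line j _,
    (isPentagonal_pyr.inner_line_false 0 i).mpr hi⟩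

/-- The added vector spans `pyrLine (0, false)`, so of the ten lines only those orthogonal to it
stay in the complement. -/
theorem IsPyrU.exists_eq_smul_pyrLine (hu : IsPyrU u) {ψ : Space ![3, 4]}
    (hψ : IsProductState ψ) (hmem : ψ ∈ compl (pyr34Plus u)) :
    ∃ i ∈ IsPentagonal.neighbours 0, ∃ c : ℂ, c ≠ 0 ∧ ψ = c • pyrLine i := by
  obtain ⟨h1, h2⟩ := hu.mem_compl_iff.mp hmem
  obtain ⟨i, c, rfl⟩ := ProductBasis.exists_eq_smul_pyrLine hψ h1
  have hc : c ≠ 0 := by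
    rintro rfl
    exact hψ.ne_zero (zero_smul _ _)
  rw [inner_smul_right] at h2
  exact ⟨i, (isPentagonal_pyr.inner_line_false 0 i).mp ((mul_eq_zero.mp h2).resolve_left hc),
    c, hc, rfl⟩

theorem isProductState_normalized_pyrLine (i : Fin 5 × Bool) :
    IsProductState (((‖pyrLine i‖⁻¹ : ℝ) : ℂ) • pyrLine i) := by
  refine isProductState_smul_tmul _ _ _ ?_
  change ‖((‖pyrLine i‖⁻¹ : ℝ) : ℂ) • pyrLine i‖ = 1
  rw [norm_smul, Complex.norm_real, norm_inv, norm_norm,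
    inv_mul_cancel₀ (norm_ne_zero_iff.mpr (pyrLine_ne_zero i))]

theorem span_pyrLine_injective : Function.Injective fun i => Submodule.span ℂ {pyrLine i} :=
  isPentagonal_pyr.span_line_injective

theorem card_neighbours_zero : (IsPentagonal.neighbours 0).card = 4 := by decide

-- Four lines cannot span the six-dimensional complement.
open Classical in
theorem IsPyrU.not_isSeparable (hu : IsPyrU u) : ¬ IsSeparable (complState (pyr34Plus u)) := by
  refine hu.isPB.not_isSeparable_complState
    (Submodule.span ℂ ((IsPentagonal.neighbours 0).image pyrLine : Finset (Space ![3, 4])))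
    (fun ψ hψ hprod => ?_) ?_
  · obtain ⟨i, hi, c, -, rfl⟩ := hu.exists_eq_smul_pyrLine hprod hψ
    exact Submodule.smul_mem _ _ (Submodule.subset_span (Finset.mem_image_of_mem _ hi))
  · rw [hu.finrank_compl]
    refine (finrank_span_finset_le_card _).trans_lt (Finset.card_image_le.trans_lt ?_)
    rw [card_neighbours_zero]
    norm_num

theorem IsPyrU.not_isUPB (hu : IsPyrU u) : ¬ IsUPB (pyr34Plus u) := fun h =>
  h.2 _ (Submodule.smul_mem _ _ (hu.pyrLine_mem (i := (2, false)) (by decide)))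
    (isProductState_normalized_pyrLine (2, false))

theorem IsPyrU.productLines_eq (hu : IsPyrU u) :
    productLines (complState (pyr34Plus u)) =
      (fun i => Submodule.span ℂ {pyrLine i}) '' (IsPentagonal.neighbours 0 : Set (Fin 5 × Bool)) := by
  ext L
  rw [productLines, hu.isPB.range_complState hu.card_lt]
  constructor
  · rintro ⟨ψ, hψ, hmem, rfl⟩
    obtain ⟨i, hi, c, hc, rfl⟩ := hu.exists_eq_smul_pyrLine hψ hmem
    exact ⟨i, hi, (Submodule.span_singleton_smul_eq (IsUnit.mk0 c hc) _).symm⟩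
  · rintro ⟨i, hi, rfl⟩
    refine ⟨_, isProductState_normalized_pyrLine i, Submodule.smul_mem _ _ (hu.pyrLine_mem hi), ?_⟩
    refine (Submodule.span_singleton_smul_eq (IsUnit.mk0 _ ?_) _).symm
    exact Complex.ofReal_ne_zero.mpr (inv_ne_zero (norm_ne_zero_iff.mpr (pyrLine_ne_zero i)))

theorem IsPyrU.encard_productLines (hu : IsPyrU u) :
    (productLines (complState (pyr34Plus u))).encard = 4 := by
  rw [hu.productLines_eq, span_pyrLine_injective.encard_image,
    Set.encard_coe_eq_coe_finsetCard, card_neighbours_zero]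
  rfl

end Plus

end Pyr34Bases

end ProductBasis

end

open Classical in
theorem lemma3 :
    (∀ (m : ℕ) (d : Fin m → ℕ) (S : Finset (Space d)), IsUCPB S →
      ∃ T : Finset (Space d), IsPB T ∧ (∀ ψ ∈ S, ∀ χ ∈ T, inner ℂ ψ χ = 0) ∧
        IsBoundEntangled (complState (S ∪ T))) ∧
    IsUCPB pyr34 ∧
    (∃ u : EuclideanSpace ℂ (Fin 4), IsPyrU u) ∧
    (∀ u : EuclideanSpace ℂ (Fin 4), IsPyrU u →
      (pyr34Plus u).card = 6 ∧
      IsSUCPB (pyr34Plus u) ∧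
      ¬ IsUPB (pyr34Plus u) ∧
      (complState (pyr34Plus u)).rank = 6 ∧
      IsBoundEntangled (complState (pyr34Plus u)) ∧
      (productLines (complState (pyr34Plus u))).encard = 4) :=
  ⟨fun _ _ _ hS => hS.exists_isBoundEntangled, isUCPB_pyr34, exists_isPyrU, fun _ hu =>
    ⟨hu.card_eq, hu.isPB.isSUCPB_of_not_isSeparable hu.not_isSeparable, hu.not_isUPB,
      (hu.isPB.rank_complState hu.card_lt).trans hu.finrank_compl,
      hu.isPB.isBoundEntangled_complState 0 hu.card_lt hu.not_isSeparable,
      hu.encard_productLines⟩⟩
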